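/- Let $n\ge 0$ and let $M$ be a smooth manifold of dimension $2n+1$ with an almost cokähler structure $(\alpha,\omega,g)$: $g$ is a Riemannian metric, $\alpha$ is a closed $1$-form and $\omega$ is a closed $2$-form such that each point of $M$ has an orthonormal coframe $e^1,\dots,e^{2n+1}$ with $\alpha=e^{2n+1}$ and $\omega=e^1\wedge e^2+\dots+e^{2n-1}\wedge e^{2n}$. Assume that $g$ is Einstein, $\mathrm{Ric}=\tau g$ with $\tau$ a constant. Conventions: $R(X,Y)Z=\nabla_X\nabla_YZ-\nabla_Y\nabla_XZ-\nabla_{[X,Y]}Z$ for the Levi-Civita connection $\nabla$; $\langle\beta,\gamma\rangle=\frac12\sum_{i,j}\beta(e_i,e_j)\gamma(e_i,e_j)$ for $2$-forms, where $(e_i)$ is an orthonormal frame; a $2$-form $\omega$ defines an endomorphism $J$ by $\omega(X,Y)=g(JX,Y)$, and the $*$-Ricci form is $\rho^*(X,Y)=\sum_i g(R(X,e_i)(Je_i),Y)$. On $M$ put $\tau^*=\frac1n\langle\omega,\rho^*\rangle$, a function on $M$ (for $n=0$, where $\omega=0$, put $\tau^*=0$). An almost Kähler structure is a Riemannian metric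 $h$ with a closed $2$-form $\Omega$ whose endomorphism $J$, $\Omega(X,Y)=h(JX,Y)$, satisfies $J^2=-\mathrm{id}$ and $h(JX,JY)=h(X,Y)$. For such a structure $s=2\langle\rho,\Omega\rangle$ and $s^*=2\langle\rho^*,\Omega\rangle$, where $\rho(X,Y)=\mathrm{Ric}'(JX,Y)$ and $\mathrm{Ric}'$ is the $J$-invariant part of the Ricci tensor; $s$ is then the Riemannian scalar curvature. Let $\pi_1,\pi_2\colon M\times M\to M$ be the projections. Then $$h=\pi_1^*g+\pi_2^*g,\qquad \Omega=\pi_1^*\omega+\pi_2^*\omega+\pi_1^*\alpha\wedge\pi_2^*\alpha$$ is an almost Kähler structure on $M\times M$; it is Einstein, with $\mathrm{Ric}_h=\tau h$; both its Riemannian scalar curvature and $2\langle\rho,\Omega\rangle$ are equal to $$s=(4n+2)\tau,$$ and for all $p,q\in M$ $$s^*(p,q)=2n\bigl(\tau^*(p)+\tau^*(q)\bigr).$$ In particular $s^*=4n\tau^*$ if $\tau^*$ is constant. -/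

import Mathlib

set_option maxSynthPendingDepth 3

open Set Bundle
open scoped Manifold

noncomputable section

namespace AlmostCokahler

/-! ### Linear algebra of a scalar product on a finite-dimensional space -/

section LinearAlgebra

variable {V : Type*} [AddCommGroup V] [Module ℝ V] [TopologicalSpace V]

/-- The metric contraction `∑ g^{ij} B(b_i, b_j)` of a bilinear form `B`, written in some basis
`b` of `V`, where `(g^{ij})` is the inverse of the Gram matrix `(g(b_i, b_j))`. In a `g`-orthonormal
basis `e` it is `∑ B(e_i, e_i)`, see `metricTrace_eq_sum`. -/
def metricTrace [FiniteDimensional ℝ V] (g : V →L[ℝ] V →L[ℝ] ℝ) (B : V → V → ℝ) : ℝ :=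
  ∑ i, ∑ j, (Matrix.of fun k l =>
    g (Module.finBasis ℝ V k) (Module.finBasis ℝ V l))⁻¹ i j *
      B (Module.finBasis ℝ V i) (Module.finBasis ℝ V j)

/-- The inner product of two `2`-forms, `½ ∑ β(e_i, e_j) γ(e_i, e_j)` in an orthonormal basis, so
that the forms `e^i ∧ e^j`, `i < j`, are orthonormal. -/
def formInner [FiniteDimensional ℝ V] (g : V →L[ℝ] V →L[ℝ] ℝ) (β γ : V → V → ℝ) : ℝ :=
  (1 / 2) * metricTrace g fun u u' => metricTrace g fun v v' => β u v * γ u' v'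

/-- The endomorphism `J` attached to a `2`-form: `g(J u, v) = ω(u, v)`, see `inner_fundEndo`. -/
def fundEndo (g : V →L[ℝ] V →L[ℝ] ℝ) (ω : V [⋀^Fin 2]→L[ℝ] ℝ) (u : V) : V :=
  g.inverse (ω.toContinuousMultilinearMap.toContinuousLinearMap ![u, 0] 1)

theorem metricTrace_eq_sum [FiniteDimensional ℝ V] {ι : Type*} [Fintype ι] [DecidableEq ι]
    (g : V →L[ℝ] V →L[ℝ] ℝ) (B : V →ₗ[ℝ] V →ₗ[ℝ] ℝ) (e : Module.Basis ι ℝ V)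
    (he : ∀ i j, g (e i) (e j) = if i = j then 1 else 0) :
    metricTrace g (fun u v => B u v) = ∑ i, B (e i) (e i) := by
  set b := Module.finBasis ℝ V
  have hgram : ∀ C : V →ₗ[ℝ] V →ₗ[ℝ] ℝ, (Matrix.of fun k l => C (b k) (b l)) =
      (e.toMatrix b).transpose * (Matrix.of fun i j => C (e i) (e j)) * e.toMatrix b := by
    intro C
    ext k l
    conv_lhs => rw [Matrix.of_apply, ← e.sum_toMatrix_smul_self b k, ← e.sum_toMatrix_smul_self b l]
    simp only [map_sum, map_smul, LinearMap.sum_apply, LinearMap.smul_apply, smul_eq_mul,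
      Matrix.mul_apply, Matrix.transpose_apply, Matrix.of_apply, Finset.sum_mul, Finset.mul_sum]
    refine Finset.sum_congr rfl fun j _ => Finset.sum_congr rfl fun i _ => ?_
    ring
  let g' : V →ₗ[ℝ] V →ₗ[ℝ] ℝ := LinearMap.mk₂ ℝ (fun u v => g u v)
    (by simp) (by simp) (by simp) (by simp)
  have hg : (Matrix.of fun k l => g (b k) (b l)) = (e.toMatrix b).transpose * e.toMatrix b := by
    have h := hgram g'
    have h1 : (Matrix.of fun i j => g' (e i) (e j)) = (1 : Matrix ι ι ℝ) := by
      ext i j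
      simp [g', he, Matrix.one_apply]
    rw [h1, Matrix.mul_one] at h
    exact h
  have hPQ : e.toMatrix b * b.toMatrix e = 1 := e.toMatrix_mul_toMatrix_flip b
  have hQP : b.toMatrix e * e.toMatrix b = 1 := b.toMatrix_mul_toMatrix_flip e
  have hinv : (Matrix.of fun k l => g (b k) (b l))⁻¹ =
      b.toMatrix e * (b.toMatrix e).transpose := by
    apply Matrix.inv_eq_left_inv
    rw [hg, Matrix.mul_assoc, ← Matrix.mul_assoc (b.toMatrix e).transpose, ← Matrix.transpose_mul,
      hPQ, Matrix.transpose_one, Matrix.one_mul, hQP]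
  have htr : metricTrace g (fun u v => B u v) = Matrix.trace
      ((Matrix.of fun k l => g (b k) (b l))⁻¹ * (Matrix.of fun k l => B (b k) (b l)).transpose) := by
    simp only [metricTrace, Matrix.trace, Matrix.diag, Matrix.mul_apply, Matrix.transpose_apply]
    rfl
  rw [htr, hinv, hgram B, Matrix.transpose_mul, Matrix.transpose_mul, Matrix.transpose_transpose,
    Matrix.mul_assoc, Matrix.trace_mul_comm, ← Matrix.mul_assoc, ← Matrix.transpose_mul, hPQ,
    Matrix.transpose_one, Matrix.one_mul, Matrix.mul_assoc, hPQ, Matrix.mul_one,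
    Matrix.trace_transpose]
  rfl

theorem apply_inverse {E : Type*} [NormedAddCommGroup E] [NormedSpace ℝ E] [FiniteDimensional ℝ E]
    (g : E →L[ℝ] E →L[ℝ] ℝ) (pos : ∀ v, v ≠ 0 → 0 < g v v) (f : E →L[ℝ] ℝ) :
    g (g.inverse f) = f := by
  have inj : Function.Injective g.toLinearMap := by
    rw [← LinearMap.ker_eq_bot, LinearMap.ker_eq_bot']
    intro v hv
    by_contra hne
    have h := pos v hne
    have h0 : g v = 0 := hv
    simp [h0] at h
  have hdim : Module.finrank ℝ E = Module.finrank ℝ (E →L[ℝ] ℝ) := by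
    rw [← LinearMap.toContinuousLinearMap.finrank_eq, Subspace.dual_finrank_eq]
  let l : E ≃L[ℝ] (E →L[ℝ] ℝ) :=
    (LinearEquiv.ofInjectiveOfFinrankEq g.toLinearMap inj hdim).toContinuousLinearEquiv
  have hl : (l : E →L[ℝ] (E →L[ℝ] ℝ)) = g := by
    ext u v
    rfl
  rw [← hl, ContinuousLinearMap.inverse_equiv]
  exact l.apply_symm_apply f

theorem inner_fundEndo {E : Type*} [NormedAddCommGroup E] [NormedSpace ℝ E]
    [FiniteDimensional ℝ E] (g : E →L[ℝ] E →L[ℝ] ℝ) (pos : ∀ v, v ≠ 0 → 0 < g v v)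
    (ω : E [⋀^Fin 2]→L[ℝ] ℝ) (u v : E) : g (fundEndo g ω u) v = ω ![u, v] := by
  rw [fundEndo, apply_inverse g pos]
  have h : Function.update ![u, 0] 1 v = ![u, v] := by
    ext i
    fin_cases i <;> simp
  change ω (Function.update ![u, 0] 1 v) = ω ![u, v]
  rw [h]

end LinearAlgebra

/-! ### Tensors in charts -/

section Manifold

variable {E : Type*} [NormedAddCommGroup E] [NormedSpace ℝ E]
  {H : Type*} [TopologicalSpace H] (I : ModelWithCorners ℝ E H)
  {M : Type*} [TopologicalSpace M] [ChartedSpace H M]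

variable (M) in
/-- A (not necessarily smooth) field of alternating `k`-forms on the tangent spaces of `M`. -/
abbrev FormField (k : ℕ) : Type _ := (p : M) → TangentSpace I p [⋀^Fin k]→L[ℝ] ℝ

variable (M) in
/-- A (not necessarily smooth) field of bilinear forms on the tangent spaces of `M`. -/
abbrev BilinField : Type _ := (p : M) → TangentSpace I p →L[ℝ] TangentSpace I p →L[ℝ] ℝ

/-- The derivative at `y` of the inverse of the chart at `x₀`: it sends the standard vector `v` to
the tangent vector with constant coordinates `v` in that chart. -/
def coordFrame (x₀ : M) (y : E) : E →L[ℝ] TangentSpace I ((extChartAt I x₀).symm y) :=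
  mfderiv 𝓘(ℝ, E) I (extChartAt I x₀).symm y

variable {I}

theorem coordFrame_self [IsManifold I 1 M] [I.Boundaryless] (p : M) (v : E) :
    coordFrame I p (extChartAt I p p) v = v := by
  have h0 := fderivWithin_extChartAt_comp_extChartAt_symm_range (I := I) (x := p)
  have h1 := TangentBundle.symmL_trivializationAt (𝕜 := ℝ) (I := I) (mem_chart_source H p)
  rw [I.range_eq_univ, mfderivWithin_univ] at h1
  have h2 : ((trivializationAt E (TangentSpace I) p).symmL ℝ p : E →L[ℝ] E) v = v := by
    rw [TangentBundle.symmL_trivializationAt_eq_core (mem_chart_source H p)]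
    exact (tangentBundleCore I M).coordChange_self (achart H p) p (mem_chart_source H p) v
  rw [h1] at h2
  exact h2

/-- The expression of a field of `k`-forms in the chart at `x₀`. -/
def FormField.inChart {k : ℕ} (ω : FormField I M k) (x₀ : M) (y : E) : E [⋀^Fin k]→L[ℝ] ℝ :=
  (ω ((extChartAt I x₀).symm y)).compContinuousLinearMap (coordFrame I x₀ y)

/-- A smooth differential form: its expression in every chart is smooth. -/
def FormField.IsSmooth {k : ℕ} (ω : FormField I M k) : Prop :=
  ∀ x₀ : M, ContDiffOn ℝ (⊤ : ℕ∞) (ω.inChart x₀) (extChartAt I x₀).target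

/-- A closed differential form: `dω = 0` in every chart. -/
def FormField.IsClosed {k : ℕ} (ω : FormField I M k) : Prop :=
  ∀ x₀ : M, ∀ y ∈ (extChartAt I x₀).target, extDeriv (ω.inChart x₀) y = 0

/-- The expression `g_{ij}` of a metric in the chart at `x₀`. -/
def BilinField.inChart (g : BilinField I M) (x₀ : M) (y : E) : E →L[ℝ] E →L[ℝ] ℝ :=
  (ContinuousLinearMap.precomp ℝ (coordFrame I x₀ y)).comp
    ((g ((extChartAt I x₀).symm y)).comp (coordFrame I x₀ y))

/-- The Christoffel symbol of the first kind of a metric `G` on an open set of `E`: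
`½ (∂_u G(v, w) + ∂_v G(u, w) - ∂_w G(u, v))`, see `christoffelFirst_apply`. -/
def christoffelFirst (G : E → E →L[ℝ] E →L[ℝ] ℝ) (y : E) : E →L[ℝ] E →L[ℝ] E →L[ℝ] ℝ :=
  let dG : E →L[ℝ] E →L[ℝ] E →L[ℝ] ℝ := fderiv ℝ G y
  let dG' : E →L[ℝ] E →L[ℝ] E →L[ℝ] ℝ :=
    (ContinuousLinearMap.flipₗᵢ ℝ E E ℝ).toContinuousLinearEquiv.toContinuousLinearMap.comp dG.flip
  (1 / 2 : ℝ) • (dG + dG.flip - dG')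

theorem christoffelFirst_apply (G : E → E →L[ℝ] E →L[ℝ] ℝ) (y u v w : E) :
    christoffelFirst G y u v w =
      (1 / 2) * (fderiv ℝ G y u v w + fderiv ℝ G y v u w - fderiv ℝ G y w u v) := by
  simp [christoffelFirst]

/-- The Levi-Civita connection of a metric `G` on an open set of `E`: `Γ(u, v) = ∇_u v` for the
constant vector fields `u`, `v`. It is the vector with
`G(Γ(u, v), w) = ½ (∂_u G(v, w) + ∂_v G(u, w) - ∂_w G(u, v))`, see `inner_christoffel`. -/
def christoffel (G : E → E →L[ℝ] E →L[ℝ] ℝ) (y : E) : E →L[ℝ] E →L[ℝ] E :=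
  (ContinuousLinearMap.compL ℝ E (E →L[ℝ] ℝ) E (G y).inverse).comp (christoffelFirst G y)

theorem inner_christoffel [FiniteDimensional ℝ E] (G : E → E →L[ℝ] E →L[ℝ] ℝ) (y : E)
    (pos : ∀ v, v ≠ 0 → 0 < G y v v) (u v w : E) :
    G y (christoffel G y u v) w = christoffelFirst G y u v w := by
  have h := congrArg (fun f : E →L[ℝ] ℝ => f w) (apply_inverse (G y) pos (christoffelFirst G y u v))
  simpa [christoffel] using h

/-- The curvature `R(u, v) w = ∇_u ∇_v w - ∇_v ∇_u w` (constant fields `u`, `v`, `w`) of a metric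
`G` on an open set of `E`, as the linear map `u ↦ R(u, v) w`. -/
def curvatureMap (G : E → E →L[ℝ] E →L[ℝ] ℝ) (y : E) (v w : E) : E →L[ℝ] E :=
  ((fderiv ℝ (christoffel G) y).flip v).flip w
    - ((fderiv ℝ (christoffel G) y v).flip w)
    + (christoffel G y).flip (christoffel G y v w)
    - (christoffel G y v).comp ((christoffel G y).flip w)

theorem curvatureMap_apply (G : E → E →L[ℝ] E →L[ℝ] ℝ) (y u v w : E) :
    curvatureMap G y v w u =
      (fderiv ℝ (christoffel G) y u v w + christoffel G y u (christoffel G y v w))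
        - (fderiv ℝ (christoffel G) y v u w + christoffel G y v (christoffel G y u w)) := by
  simp [curvatureMap]
  abel

/-- The Riemann curvature `R(u, v) w = ∇_u ∇_v w - ∇_v ∇_u w - ∇_{[u, v]} w` of a metric `g` on `M`
at `p`, as the linear map `u ↦ R(u, v) w`. It is computed in the preferred chart at `p`, through
which `TangentSpace I p` is by definition identified with `E` (see `coordFrame_self`). -/
def curvature (g : BilinField I M) (p : M) (v w : TangentSpace I p) :
    TangentSpace I p →L[ℝ] TangentSpace I p :=
  (curvatureMap (g.inChart p) (extChartAt I p p) v w : E →L[ℝ] E)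

/-- The Ricci tensor `Ric(v, w) = tr (u ↦ R(u, v) w)`. -/
def ricci (g : BilinField I M) (p : M) (v w : TangentSpace I p) : ℝ :=
  LinearMap.trace ℝ (TangentSpace I p) (curvature g p v w)

/-- The metric `g` satisfies `Ric = τ g` with the constant `τ`. -/
def IsEinstein (g : BilinField I M) (τ : ℝ) : Prop :=
  ∀ (p : M) (u v : TangentSpace I p), ricci g p u v = τ * g p u v

variable [FiniteDimensional ℝ E]

instance (p : M) : FiniteDimensional ℝ (TangentSpace I p) :=
  inferInstanceAs (FiniteDimensional ℝ E)

/-- The Riemannian scalar curvature, the metric trace of the Ricci tensor. -/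
def scalarCurvature (g : BilinField I M) (p : M) : ℝ :=
  metricTrace (g p) (ricci g p)

/-- The `*`-Ricci form `ρ*(X, Y) = ∑ g(R(X, e_i) (J e_i), Y)`, `e` an orthonormal frame, where `J`
is the endomorphism with `ω(u, v) = g(J u, v)`. On an almost contact metric manifold `J` vanishes on
the Reeb field, so that the Reeb field does not contribute to the sum. -/
def starRicciForm (g : BilinField I M) (ω : FormField I M 2) (p : M) (X Y : TangentSpace I p) : ℝ :=
  metricTrace (g p) fun u v => g p (curvature g p u (fundEndo (g p) (ω p) v) X) Y

/-- `τ* = (1/n) ⟨ω, ρ*⟩`, for an almost contact metric manifold of dimension `2n+1`. -/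
def tauStar (n : ℕ) (g : BilinField I M) (ω : FormField I M 2) (p : M) : ℝ :=
  (1 / (n : ℝ)) * formInner (g p) (fun u v => ω p ![u, v]) (starRicciForm g ω p)

/-- The Ricci form `ρ(X, Y) = Ric'(J X, Y)` of an almost Hermitian manifold, where
`Ric'(X, Y) = ½ (Ric(X, Y) + Ric(J X, J Y))` is the `J`-invariant part of the Ricci tensor. -/
def ricciForm (h : BilinField I M) (Ω : FormField I M 2) (p : M) (X Y : TangentSpace I p) : ℝ :=
  let J := fundEndo (h p) (Ω p)
  (1 / 2) * (ricci h p (J X) Y + ricci h p (J (J X)) (J Y))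

/-- The scalar curvature `s = 2 ⟨ρ, Ω⟩` of an almost Hermitian manifold. -/
def hermitianScalar (h : BilinField I M) (Ω : FormField I M 2) (p : M) : ℝ :=
  2 * formInner (h p) (ricciForm h Ω p) (fun u v => Ω p ![u, v])

/-- The `*`-scalar curvature `s* = 2 ⟨ρ*, Ω⟩` of an almost Hermitian manifold. -/
def starScalar (h : BilinField I M) (Ω : FormField I M 2) (p : M) : ℝ :=
  2 * formInner (h p) (starRicciForm h Ω p) (fun u v => Ω p ![u, v])

/-- `(α, ω, g)` is an almost cokähler structure on a manifold of dimension `2n+1`: the forms are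
smooth, at each point there is an orthonormal coframe with `α = e^{2n+1}` and
`ω = e^1 ∧ e^2 + ⋯ + e^{2n-1} ∧ e^{2n}`, and both forms are closed. The index `inl (k, 0)` stands for
`2k-1`, the index `inl (k, 1)` for `2k` and the index `inr ()` for `2n+1`. -/
structure IsAlmostCokahler (n : ℕ) (g : BilinField I M) (α : FormField I M 1)
    (ω : FormField I M 2) : Prop where
  smooth_one : α.IsSmooth
  smooth_two : ω.IsSmooth
  coframe : ∀ p : M, ∃ e : Module.Basis ((Fin n × Fin 2) ⊕ Unit) ℝ (TangentSpace I p),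
    (∀ i j, g p (e i) (e j) = if i = j then 1 else 0) ∧
    (∀ u, α p ![u] = e.coord (.inr ()) u) ∧
    ∀ u v, ω p ![u, v] = ∑ k : Fin n,
      (e.coord (.inl (k, 0)) u * e.coord (.inl (k, 1)) v
        - e.coord (.inl (k, 1)) u * e.coord (.inl (k, 0)) v)
  closed_one : α.IsClosed
  closed_two : ω.IsClosed

/-- `(h, Ω)`, together with the endomorphism field `J` given by `Ω(u, v) = h(J u, v)`, is an almost
Kähler structure: `Ω` is a smooth closed form, `J` is an almost complex structure and `h` is
`J`-Hermitian. As `h` and `Ω` are smooth, so is `J`. -/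
structure IsAlmostKahler (h : BilinField I M) (Ω : FormField I M 2) : Prop where
  smooth : Ω.IsSmooth
  complex : ∀ p u, fundEndo (h p) (Ω p) (fundEndo (h p) (Ω p) u) = -u
  hermitian : ∀ p u v, h p (fundEndo (h p) (Ω p) u) (fundEndo (h p) (Ω p) v) = h p u v
  closed : Ω.IsClosed

end Manifold

/-! ### Products -/

section Product

variable {E : Type*} [NormedAddCommGroup E] [NormedSpace ℝ E]
  {H : Type*} [TopologicalSpace H] {I : ModelWithCorners ℝ E H}
  {M : Type*} [TopologicalSpace M] [ChartedSpace H M]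

variable (I) in
/-- The differential of the first projection `M × M → M`. -/
def dfst (z : M × M) : TangentSpace (I.prod I) z →L[ℝ] TangentSpace I z.1 :=
  mfderiv (I.prod I) I Prod.fst z

variable (I) in
/-- The differential of the second projection `M × M → M`. -/
def dsnd (z : M × M) : TangentSpace (I.prod I) z →L[ℝ] TangentSpace I z.2 :=
  mfderiv (I.prod I) I Prod.snd z

/-- `h = π₁^* g + π₂^* g`. -/
def IsProductMetric (g : BilinField I M) (h : BilinField (I.prod I) (M × M)) : Prop :=
  ∀ z u v, h z u v = g z.1 (dfst I z u) (dfst I z v) + g z.2 (dsnd I z u) (dsnd I z v)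

/-- `Ω = π₁^* ω + π₂^* ω + π₁^* α ∧ π₂^* α`. -/
def IsProductForm (α : FormField I M 1) (ω : FormField I M 2)
    (Ω : FormField (I.prod I) (M × M) 2) : Prop :=
  ∀ z u v, Ω z ![u, v] =
    ω z.1 ![dfst I z u, dfst I z v] + ω z.2 ![dsnd I z u, dsnd I z v]
      + (α z.1 ![dfst I z u] * α z.2 ![dsnd I z v] - α z.1 ![dfst I z v] * α z.2 ![dsnd I z u])

end Product

end AlmostCokahler

end

/-! Everything is read off in product charts, where $h$ is the block sum of two copies of the
metric, each depending on its own variable only. The Christoffel symbols, and then the curvature,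
split into blocks (`christoffel_prod`, `curvatureMap_prod`). The Ricci tensor is a trace, so it is
the sum of those of the factors, and $h$ is Einstein with the same $\tau$.

The form $\Omega$ is closed because pullbacks of closed forms and wedge products of closed $1$-forms
are closed (`extDeriv_wedge`). With $\xi_i$ the Reeb vectors, its endomorphism is
$J(u_1,u_2)=(J_1u_1-\alpha_2(u_2)\xi_1,\ J_2u_2+\alpha_1(u_1)\xi_2)$ (`fundEndo_prod`). Since
$J_i^2=-1+\alpha_i\otimes\xi_i$, $J_i\xi_i=0$ and $\alpha_i\circ J_i=0$, the rotation of the plane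
of $\xi_1,\xi_2$ supplies exactly what $J_1\oplus J_2$ lacks, and $J^2=-1$. Compatibility with $h$
follows from the skewness of $\Omega$.

The Einstein condition gives $\rho=\tau\Omega$, and $2\langle\Omega,\Omega\rangle$ is the dimension
$4n+2$. In $\rho^*$ the mixed part of $J$ is annihilated by the block curvature, so $\rho^*$ is the
sum of the pullbacks of the forms of the factors (`starForm_prod`). This sum has no mixed
components, hence does not see $\alpha\wedge\alpha$ when paired with $\Omega$ (`formInner_prod`).
What remains is $\langle\rho^*,\omega\rangle=n\tau^*$ for each factor. -/

namespace AlmostCokahler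

/-! ### Curvature of a product metric on an open set of a vector space -/

section ProductCurvature

open Filter Topology

variable {E F X Y : Type*} [NormedAddCommGroup E] [NormedSpace ℝ E] [FiniteDimensional ℝ E]
  [NormedAddCommGroup F] [NormedSpace ℝ F]
  [NormedAddCommGroup X] [NormedSpace ℝ X] [FiniteDimensional ℝ X]
  [NormedAddCommGroup Y] [NormedSpace ℝ Y]

/-- The pullback of a vector-valued bilinear map along `q`, followed by `j`, as a continuous linear
function of the bilinear map. -/
noncomputable def bilinPull (q : F →L[ℝ] E) (j : X →L[ℝ] Y) :
    (E →L[ℝ] E →L[ℝ] X) →L[ℝ] (F →L[ℝ] F →L[ℝ] Y) :=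
  LinearMap.toContinuousLinearMap
    { toFun := fun B => (ContinuousLinearMap.compL ℝ F X Y j).comp (B.bilinearComp q q)
      map_add' := fun B C => by ext; simp
      map_smul' := fun c B => by ext; simp }

@[simp] theorem bilinPull_apply (q : F →L[ℝ] E) (j : X →L[ℝ] Y) (B : E →L[ℝ] E →L[ℝ] X) (u v : F) :
    bilinPull q j B u v = j (B (q u) (q v)) := rfl

/-- The direct sum of two bilinear maps. -/
noncomputable def bilinProd (B C : E →L[ℝ] E →L[ℝ] ℝ) : E × E →L[ℝ] E × E →L[ℝ] ℝ :=
  bilinPull (.fst ℝ E E) (.id ℝ ℝ) B + bilinPull (.snd ℝ E E) (.id ℝ ℝ) C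

@[simp] theorem bilinProd_apply (B C : E →L[ℝ] E →L[ℝ] ℝ) (u v : E × E) :
    bilinProd B C u v = B u.1 v.1 + C u.2 v.2 := rfl

theorem contDiffAt_bilinProd {n : WithTop ℕ∞} {G₁ G₂ : E → E →L[ℝ] E →L[ℝ] ℝ} {y : E × E}
    (h₁ : ContDiffAt ℝ n G₁ y.1) (h₂ : ContDiffAt ℝ n G₂ y.2) :
    ContDiffAt ℝ n (fun y : E × E => bilinProd (G₁ y.1) (G₂ y.2)) y :=
  ((bilinPull (.fst ℝ E E) (.id ℝ ℝ)).contDiff.contDiffAt.comp y (h₁.comp y contDiffAt_fst)).add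
    ((bilinPull (.snd ℝ E E) (.id ℝ ℝ)).contDiff.contDiffAt.comp y (h₂.comp y contDiffAt_snd))

theorem bilinProd_pos {B C : E →L[ℝ] E →L[ℝ] ℝ} (hB : ∀ v, v ≠ 0 → 0 < B v v)
    (hC : ∀ v, v ≠ 0 → 0 < C v v) (v : E × E) (hv : v ≠ 0) : 0 < bilinProd B C v v := by
  have nn : ∀ {D : E →L[ℝ] E →L[ℝ] ℝ}, (∀ v, v ≠ 0 → 0 < D v v) → ∀ v, 0 ≤ D v v := by
    intro D hD v
    rcases eq_or_ne v 0 with rfl | h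
    · simp
    · exact (hD v h).le
  rw [bilinProd_apply]
  by_cases h : v.1 = 0
  · exact add_pos_of_nonneg_of_pos (nn hB _) (hC _ fun h' => hv (Prod.ext h h'))
  · exact add_pos_of_pos_of_nonneg (hB _ h) (nn hC _)

-- The difference `u - v` pairs to zero with itself. Vectors defined through the inverse metric
-- (Christoffel symbols, `fundEndo`) are identified in this way, without computing the inverse.
omit [FiniteDimensional ℝ E] in
theorem eq_of_pos {g : E →L[ℝ] E →L[ℝ] ℝ} (pos : ∀ v, v ≠ 0 → 0 < g v v) {u v : E}
    (h : ∀ w, g u w = g v w) : u = v := by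
  by_contra hne
  have h1 := pos (u - v) (sub_ne_zero.mpr hne)
  simp [h] at h1

theorem isInvertible_of_pos {g : E →L[ℝ] E →L[ℝ] ℝ} (pos : ∀ v, v ≠ 0 → 0 < g v v) :
    g.IsInvertible := by
  have inj : Function.Injective g.toLinearMap := fun u v h =>
    eq_of_pos pos fun w => congrArg (fun f : E →L[ℝ] ℝ => f w) h
  have hdim : Module.finrank ℝ E = Module.finrank ℝ (E →L[ℝ] ℝ) := by
    rw [← LinearMap.toContinuousLinearMap.finrank_eq, Subspace.dual_finrank_eq]
  exact ⟨(LinearEquiv.ofInjectiveOfFinrankEq g.toLinearMap inj hdim).toContinuousLinearEquiv, rfl⟩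

/-- The symbols are the inverse metric applied to first derivatives of `G`, and inversion is smooth
at an invertible map. -/
theorem differentiableAt_christoffel {G : E → E →L[ℝ] E →L[ℝ] ℝ} {y : E} (hG : ContDiffAt ℝ 2 G y)
    (pos : ∀ v, v ≠ 0 → 0 < G y v v) : DifferentiableAt ℝ (christoffel G) y := by
  have h1 : DifferentiableAt ℝ (fun y => (G y).inverse) y :=
    (((isInvertible_of_pos pos).contDiffAt_map_inverse (n := 1)).comp y
      (hG.of_le one_le_two)).differentiableAt one_ne_zero
  have h2 : DifferentiableAt ℝ (fderiv ℝ G) y :=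
    (hG.fderiv_right (m := 1) (by norm_num)).differentiableAt one_ne_zero
  have h3 : DifferentiableAt ℝ (christoffelFirst G) y := by
    have h4 : DifferentiableAt ℝ (fun y => (fderiv ℝ G y).flip) y :=
      ((ContinuousLinearMap.flipₗᵢ ℝ E E (E →L[ℝ] ℝ)).toContinuousLinearEquiv.toContinuousLinearMap
        ).differentiableAt.comp y h2
    exact ((h2.add h4).sub ((differentiableAt_const _).clm_comp h4)).const_smul (1 / 2 : ℝ)
  exact ((ContinuousLinearMap.compL ℝ E (E →L[ℝ] ℝ) E).differentiableAt.comp y h1).clm_comp h3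

-- The block metric and its Christoffel symbols both have this shape, so one derivative formula
-- serves for both.
omit [FiniteDimensional ℝ E] [FiniteDimensional ℝ X] in
theorem hasFDerivAt_add_comp_fst_snd {f₁ f₂ : E → X} {A₁ A₂ : X →L[ℝ] Y} {y : E × E}
    (h₁ : DifferentiableAt ℝ f₁ y.1) (h₂ : DifferentiableAt ℝ f₂ y.2) :
    HasFDerivAt (fun y : E × E => A₁ (f₁ y.1) + A₂ (f₂ y.2))
      (A₁.comp ((fderiv ℝ f₁ y.1).comp (.fst ℝ E E)) +
        A₂.comp ((fderiv ℝ f₂ y.2).comp (.snd ℝ E E))) y :=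
  (A₁.hasFDerivAt.comp y (h₁.hasFDerivAt.comp y hasFDerivAt_fst)).add
    (A₂.hasFDerivAt.comp y (h₂.hasFDerivAt.comp y hasFDerivAt_snd))

variable {G : E × E → E × E →L[ℝ] E × E →L[ℝ] ℝ} {G₁ G₂ : E → E →L[ℝ] E →L[ℝ] ℝ} {y : E × E}

/-- Paired with any `w`, both sides become Koszul expressions, which are linear in the derivative of
the metric and therefore split. -/
theorem christoffel_prod (hG : G =ᶠ[𝓝 y] fun y => bilinProd (G₁ y.1) (G₂ y.2))
    (h₁ : DifferentiableAt ℝ G₁ y.1) (h₂ : DifferentiableAt ℝ G₂ y.2)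
    (pos₁ : ∀ v, v ≠ 0 → 0 < G₁ y.1 v v) (pos₂ : ∀ v, v ≠ 0 → 0 < G₂ y.2 v v) :
    christoffel G y = bilinPull (.fst ℝ E E) (.inl ℝ E E) (christoffel G₁ y.1) +
      bilinPull (.snd ℝ E E) (.inr ℝ E E) (christoffel G₂ y.2) := by
  have hd : fderiv ℝ G y = _ :=
    hG.fderiv_eq.trans (hasFDerivAt_add_comp_fst_snd h₁ h₂ (A₁ := bilinPull (.fst ℝ E E) (.id ℝ ℝ))
      (A₂ := bilinPull (.snd ℝ E E) (.id ℝ ℝ))).fderiv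
  have hy : G y = bilinProd (G₁ y.1) (G₂ y.2) := hG.eq_of_nhds
  have pos : ∀ v, v ≠ 0 → 0 < G y v v := by
    rw [hy]
    exact bilinProd_pos pos₁ pos₂
  refine ContinuousLinearMap.ext fun u => ContinuousLinearMap.ext fun v =>
    eq_of_pos pos fun w => ?_
  rw [inner_christoffel G y pos, christoffelFirst_apply, hd, hy]
  simp only [add_apply, ContinuousLinearMap.comp_apply, bilinPull_apply,
    bilinProd_apply, ContinuousLinearMap.inl_apply, ContinuousLinearMap.inr_apply, Prod.fst_add,
    Prod.snd_add, add_zero, zero_add, inner_christoffel G₁ _ pos₁, inner_christoffel G₂ _ pos₂,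
    christoffelFirst_apply, ContinuousLinearMap.coe_fst', ContinuousLinearMap.coe_snd',
    ContinuousLinearMap.id_apply]
  ring

/-- The curvature differentiates the symbols, so their splitting is needed on a neighbourhood of
`y`; hence positivity near the point. The quadratic terms do not mix, since each block of the
symbols depends only on, and takes values in, its own factor. -/
theorem curvatureMap_prod (hG : G =ᶠ[𝓝 y] fun y => bilinProd (G₁ y.1) (G₂ y.2))
    (h₁ : ContDiffAt ℝ 2 G₁ y.1) (h₂ : ContDiffAt ℝ 2 G₂ y.2)
    (pos₁ : ∀ᶠ x in 𝓝 y.1, ∀ v, v ≠ 0 → 0 < G₁ x v v)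
    (pos₂ : ∀ᶠ x in 𝓝 y.2, ∀ v, v ≠ 0 → 0 < G₂ x v v) (v w : E × E) :
    curvatureMap G y v w =
      (curvatureMap G₁ y.1 v.1 w.1).prodMap (curvatureMap G₂ y.2 v.2 w.2) := by
  have ev : ∀ {G' : E → E →L[ℝ] E →L[ℝ] ℝ} {x : E}, ContDiffAt ℝ 2 G' x →
      ∀ᶠ x' in 𝓝 x, DifferentiableAt ℝ G' x' := fun h =>
    (h.eventually (by simp)).mono fun _ hx => hx.differentiableAt two_ne_zero
  have hΓ : christoffel G =ᶠ[𝓝 y] fun y =>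
      bilinPull (.fst ℝ E E) (.inl ℝ E E) (christoffel G₁ y.1) +
      bilinPull (.snd ℝ E E) (.inr ℝ E E) (christoffel G₂ y.2) := by
    filter_upwards [hG.eventuallyEq_nhds, continuousAt_fst.eventually (ev h₁),
      continuousAt_snd.eventually (ev h₂), continuousAt_fst.eventually pos₁,
      continuousAt_snd.eventually pos₂] with x a b c d e
    exact christoffel_prod a b c d e
  have hd : fderiv ℝ (christoffel G) y = _ :=
    hΓ.fderiv_eq.trans (hasFDerivAt_add_comp_fst_snd
      (differentiableAt_christoffel h₁ pos₁.self_of_nhds)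
      (differentiableAt_christoffel h₂ pos₂.self_of_nhds)
      (A₁ := bilinPull (.fst ℝ E E) (.inl ℝ E E))
      (A₂ := bilinPull (.snd ℝ E E) (.inr ℝ E E))).fderiv
  refine ContinuousLinearMap.ext fun u => ?_
  rw [curvatureMap_apply, hd, hΓ.eq_of_nhds]
  refine Prod.ext ?_ ?_ <;> simp [curvatureMap_apply]

end ProductCurvature

/-! ### Closed forms on a product of open sets of vector spaces -/

section Wedge

variable {E F : Type*} [NormedAddCommGroup E] [NormedSpace ℝ E]
  [NormedAddCommGroup F] [NormedSpace ℝ F]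

/-- The wedge product of two linear forms. -/
def wedgeLinear (a b : E →L[ℝ] ℝ) : E [⋀^Fin 2]→L[ℝ] ℝ where
  toFun v := a (v 0) * b (v 1) - a (v 1) * b (v 0)
  map_update_add' v i x y := by
    fin_cases i <;> simp <;> ring
  map_update_smul' v i c x := by
    fin_cases i <;> simp <;> ring
  map_eq_zero_of_eq' v i j h hij := by
    fin_cases i <;> fin_cases j <;> simp_all
  cont := by fun_prop

@[simp] theorem wedgeLinear_apply (a b : E →L[ℝ] ℝ) (v : Fin 2 → E) :
    wedgeLinear a b v = a (v 0) * b (v 1) - a (v 1) * b (v 0) := rfl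

variable [FiniteDimensional ℝ E]

/-- The wedge product of two `1`-forms, as a continuous bilinear map. -/
noncomputable def wedge :
    (E [⋀^Fin 1]→L[ℝ] ℝ) →L[ℝ] (E [⋀^Fin 1]→L[ℝ] ℝ) →L[ℝ] (E [⋀^Fin 2]→L[ℝ] ℝ) :=
  ((LinearMap.mk₂ ℝ wedgeLinear
    (fun a a' b => by ext v; simp; ring)
    (fun c a b => by ext v; simp; ring)
    (fun a b b' => by ext v; simp; ring)
    (fun c a b => by ext v; simp; ring)).toContinuousBilinearMap).bilinearComp
      (ContinuousAlternatingMap.ofSubsingletonLIE (𝕜 := ℝ) (E := E) (F := ℝ)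
        (0 : Fin 1)).symm.toContinuousLinearEquiv.toContinuousLinearMap
      (ContinuousAlternatingMap.ofSubsingletonLIE (𝕜 := ℝ) (E := E) (F := ℝ)
        (0 : Fin 1)).symm.toContinuousLinearEquiv.toContinuousLinearMap

theorem wedge_apply (a b : E [⋀^Fin 1]→L[ℝ] ℝ) (v : Fin 2 → E) :
    wedge a b v = a ![v 0] * b ![v 1] - a ![v 1] * b ![v 0] := by
  have h : ∀ (c : E [⋀^Fin 1]→L[ℝ] ℝ) (u : E),
      (ContinuousAlternatingMap.ofSubsingletonLIE (𝕜 := ℝ) (E := E) (F := ℝ)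
        (0 : Fin 1)).symm c u = c ![u] := by
    intro c u
    obtain ⟨c, rfl⟩ := (ContinuousAlternatingMap.ofSubsingletonLIE (𝕜 := ℝ) (E := E) (F := ℝ)
        (0 : Fin 1)).surjective c
    simp
  rw [← h, ← h, ← h, ← h]
  rfl

-- This is $d\eta(u,v)=(D_u\eta)(v)-(D_v\eta)(u)$.
omit [FiniteDimensional ℝ E] in
theorem fderiv_one_form_symm {η : E → E [⋀^Fin 1]→L[ℝ] ℝ} {x : E} (hη : DifferentiableAt ℝ η x)
    (h : extDeriv η x = 0) (u v : E) : fderiv ℝ η x u ![v] = fderiv ℝ η x v ![u] := by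
  have h1 := congrArg (fun f => f ![u, v]) h
  simp only [extDeriv_apply hη] at h1
  replace h1 := (Fin.sum_univ_two _).symm.trans h1
  have e0 : (0 : Fin 2).removeNth ![u, v] = ![v] := by ext i; fin_cases i; rfl
  have e1 : (1 : Fin 2).removeNth ![u, v] = ![u] := by ext i; fin_cases i; rfl
  rw [e0, e1, fderiv_continuousAlternatingMap_apply_const_apply hη,
    fderiv_continuousAlternatingMap_apply_const_apply hη] at h1
  simp at h1
  linarith

/-- After the Leibniz rule, the symmetry of the derivatives of closed $1$-forms makes the terms
cancel in pairs. -/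
theorem extDeriv_wedge {η θ : E → E [⋀^Fin 1]→L[ℝ] ℝ} {x : E} (hη : DifferentiableAt ℝ η x)
    (hθ : DifferentiableAt ℝ θ x) (dη : extDeriv η x = 0) (dθ : extDeriv θ x = 0) :
    extDeriv (fun y => wedge (η y) (θ y)) x = 0 := by
  have hw : HasFDerivAt (fun y => wedge (η y) (θ y)) _ x :=
    wedge.hasFDerivAt_of_bilinear hη.hasFDerivAt hθ.hasFDerivAt
  ext v
  rw [extDeriv_apply hw.differentiableAt]
  simp only [fderiv_continuousAlternatingMap_apply_const_apply hw.differentiableAt, hw.fderiv]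
  refine (Fin.sum_univ_three _).trans ?_
  simp [wedge_apply, Fin.removeNth, Fin.succAbove, Fin.tail]
  -- Normal form: the index of the direction is smaller than that of the argument.
  rw [fderiv_one_form_symm hη dη (v 1) (v 0), fderiv_one_form_symm hη dη (v 2) (v 0),
    fderiv_one_form_symm hη dη (v 2) (v 1), fderiv_one_form_symm hθ dθ (v 1) (v 0),
    fderiv_one_form_symm hθ dθ (v 2) (v 0), fderiv_one_form_symm hθ dθ (v 2) (v 1)]
  ring

omit [FiniteDimensional ℝ E] in
theorem contDiffOn_pullback_clm {k : ℕ} {n : WithTop ℕ∞} {η : E → E [⋀^Fin k]→L[ℝ] ℝ} {s : Set E}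
    (hη : ContDiffOn ℝ n η s) (q : F →L[ℝ] E) {t : Set F} (hq : MapsTo q t s) :
    ContDiffOn ℝ n (fun y => (η (q y)).compContinuousLinearMap q) t :=
  (ContinuousAlternatingMap.compContinuousLinearMapCLM (ι := Fin k) (F := ℝ)
    q).contDiff.comp_contDiffOn (hη.comp q.contDiff.contDiffOn hq)

omit [FiniteDimensional ℝ E] in
theorem differentiableAt_pullback_clm {k : ℕ} {η : E → E [⋀^Fin k]→L[ℝ] ℝ} (q : F →L[ℝ] E) {x : F}
    (hη : DifferentiableAt ℝ η (q x)) :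
    DifferentiableAt ℝ (fun y => (η (q y)).compContinuousLinearMap q) x :=
  (ContinuousAlternatingMap.compContinuousLinearMapCLM (ι := Fin k) (F := ℝ)
    q).differentiableAt.comp x (hη.comp x q.differentiableAt)

omit [FiniteDimensional ℝ E] in
theorem extDeriv_pullback_clm {k : ℕ} {η : E → E [⋀^Fin k]→L[ℝ] ℝ} (q : F →L[ℝ] E) {x : F}
    (hη : DifferentiableAt ℝ η (q x)) (dη : extDeriv η (q x) = 0) :
    extDeriv (fun y => (η (q y)).compContinuousLinearMap q) x = 0 := by
  have h := extDeriv_pullback (r := 2) hη q.contDiff.contDiffAt (by simp)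
  simp only [ContinuousLinearMap.fderiv] at h
  rw [h, dη]
  ext
  simp

/-- The `2`-form `π₁^* w₁ + π₂^* w₂ + π₁^* a₁ ∧ π₂^* a₂` on a product of vector spaces. -/
noncomputable def prodForm (a₁ a₂ : E [⋀^Fin 1]→L[ℝ] ℝ) (w₁ w₂ : E [⋀^Fin 2]→L[ℝ] ℝ) :
    (E × E) [⋀^Fin 2]→L[ℝ] ℝ :=
  w₁.compContinuousLinearMap (.fst ℝ E E) + w₂.compContinuousLinearMap (.snd ℝ E E) +
    wedge (a₁.compContinuousLinearMap (.fst ℝ E E)) (a₂.compContinuousLinearMap (.snd ℝ E E))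

theorem prodForm_apply (a₁ a₂ : E [⋀^Fin 1]→L[ℝ] ℝ) (w₁ w₂ : E [⋀^Fin 2]→L[ℝ] ℝ) (u v : E × E) :
    prodForm a₁ a₂ w₁ w₂ ![u, v] =
      w₁ ![u.1, v.1] + w₂ ![u.2, v.2] + (a₁ ![u.1] * a₂ ![v.2] - a₁ ![v.1] * a₂ ![u.2]) := by
  have h1 : ∀ (q : E × E → E) (u : E × E), q ∘ ![u] = ![q u] := fun q u => by
    ext i; fin_cases i; rfl
  have h2 : ∀ (q : E × E → E) (u v : E × E), q ∘ ![u, v] = ![q u, q v] := fun q u v => by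
    ext i; fin_cases i <;> rfl
  simp [prodForm, wedge_apply, h1, h2]

theorem contDiffOn_prodForm {n : WithTop ℕ∞} {s t : Set E} {a₁ a₂ : E → E [⋀^Fin 1]→L[ℝ] ℝ}
    {w₁ w₂ : E → E [⋀^Fin 2]→L[ℝ] ℝ} (ha₁ : ContDiffOn ℝ n a₁ s) (ha₂ : ContDiffOn ℝ n a₂ t)
    (hw₁ : ContDiffOn ℝ n w₁ s) (hw₂ : ContDiffOn ℝ n w₂ t) :
    ContDiffOn ℝ n (fun y : E × E => prodForm (a₁ y.1) (a₂ y.2) (w₁ y.1) (w₂ y.2)) (s ×ˢ t) := by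
  have m₁ : MapsTo (ContinuousLinearMap.fst ℝ E E) (s ×ˢ t) s := fun y hy => hy.1
  have m₂ : MapsTo (ContinuousLinearMap.snd ℝ E E) (s ×ˢ t) t := fun y hy => hy.2
  exact ((contDiffOn_pullback_clm hw₁ _ m₁).add (contDiffOn_pullback_clm hw₂ _ m₂)).add
    (((wedge (E := E × E)).contDiff.comp_contDiffOn (contDiffOn_pullback_clm ha₁ _ m₁)).clm_apply
      (contDiffOn_pullback_clm ha₂ _ m₂))

theorem extDeriv_prodForm {a₁ a₂ : E → E [⋀^Fin 1]→L[ℝ] ℝ} {w₁ w₂ : E → E [⋀^Fin 2]→L[ℝ] ℝ}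
    {y : E × E} (ha₁ : DifferentiableAt ℝ a₁ y.1) (ha₂ : DifferentiableAt ℝ a₂ y.2)
    (hw₁ : DifferentiableAt ℝ w₁ y.1) (hw₂ : DifferentiableAt ℝ w₂ y.2)
    (da₁ : extDeriv a₁ y.1 = 0) (da₂ : extDeriv a₂ y.2 = 0)
    (dw₁ : extDeriv w₁ y.1 = 0) (dw₂ : extDeriv w₂ y.2 = 0) :
    extDeriv (fun y : E × E => prodForm (a₁ y.1) (a₂ y.2) (w₁ y.1) (w₂ y.2)) y = 0 := by
  have p₁ := differentiableAt_pullback_clm (.fst ℝ E E) (x := y) ha₁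
  have p₂ := differentiableAt_pullback_clm (.snd ℝ E E) (x := y) ha₂
  have q₁ := differentiableAt_pullback_clm (.fst ℝ E E) (x := y) hw₁
  have q₂ := differentiableAt_pullback_clm (.snd ℝ E E) (x := y) hw₂
  refine (extDeriv_fun_add (q₁.fun_add q₂)
    ((wedge.differentiableAt.comp y p₁).clm_apply p₂)).trans ?_
  rw [extDeriv_fun_add q₁ q₂, extDeriv_pullback_clm (.fst ℝ E E) hw₁ dw₁,
    extDeriv_pullback_clm (.snd ℝ E E) hw₂ dw₂, zero_add, zero_add]
  exact extDeriv_wedge p₁ p₂ (extDeriv_pullback_clm (.fst ℝ E E) ha₁ da₁)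
    (extDeriv_pullback_clm (.snd ℝ E E) ha₂ da₂)

end Wedge

noncomputable section

/-! ### Tensors on a product of manifolds in charts -/

section ProductCharts

open Filter Topology

variable {E : Type*} [NormedAddCommGroup E] [NormedSpace ℝ E]
  [FiniteDimensional ℝ E]
  {H : Type*} [TopologicalSpace H] {I : ModelWithCorners ℝ E H} [I.Boundaryless]
  {M : Type*} [TopologicalSpace M] [ChartedSpace H M] [IsManifold I (⊤ : ℕ∞) M]

-- The trivialization of the tangent bundle at `p` is inverted by the derivative of the inverse
-- chart, so the coordinates of the section `g` are the $g_{ij}$. It is used in both directions: to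
-- get smooth coefficients from `g`, and to make a smooth section of the product metric.
omit [FiniteDimensional ℝ E] in
theorem contMDiffAt_iff_contDiffAt_inChart [IsManifold I 1 M] (g : BilinField I M) (p : M) :
    ContMDiffAt I (I.prod 𝓘(ℝ, E →L[ℝ] E →L[ℝ] ℝ)) (⊤ : ℕ∞)
      (fun b => TotalSpace.mk' (E →L[ℝ] E →L[ℝ] ℝ)
        (E := fun b : M => TangentSpace I b →L[ℝ] TangentSpace I b →L[ℝ] ℝ) b (g b)) p ↔
      ContDiffAt ℝ (⊤ : ℕ∞) (g.inChart p) (extChartAt I p p) := by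
  refine (contMDiffAt_hom_bundle _).trans ((and_iff_right contMDiffAt_id).trans ?_)
  have key : ∀ x ∈ (chartAt H p).source,
      ContinuousLinearMap.inCoordinates E (TangentSpace I) (E →L[ℝ] ℝ)
        (fun b : M => TangentSpace I b →L[ℝ] ℝ) p x p x (g x) =
      g.inChart p (extChartAt I p x) := by
    intro x hx
    have hs : ∀ v, (trivializationAt E (TangentSpace I) p).symm x v =
        (trivializationAt E (TangentSpace I) p).symmL ℝ x v :=
      fun v => (Trivialization.symmL_apply _ (by simpa using hx) v).symm
    have h3 : Trivialization.linearMapAt ℝ (trivializationAt ℝ (fun _ : M => ℝ) p) x =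
        LinearMap.id := Bundle.Trivial.linearMapAt_trivialization ..
    ext u v
    rw [inCoordinates_apply_eq₂ (by simpa using hx) (by simpa using hx) (by simp), hs, hs, h3,
      TangentBundle.symmL_trivializationAt hx, I.range_eq_univ, mfderivWithin_univ]
    have h1 : (extChartAt I p).symm (extChartAt I p x) = x :=
      (extChartAt I p).left_inv (by simpa using hx)
    -- The two base points are only propositionally equal; the tangent spaces over them are both
    -- `E`, which lets the values be compared.
    have h2 : ∀ x', x' = x → ∀ a b : E, g x a b = g x' a b := by
      rintro _ rfl a b; rfl
    exact h2 _ h1 _ _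
  have hs := (chartAt H p).open_source.mem_nhds (mem_chart_source H p)
  constructor
  · intro h
    rw [← contMDiffAt_iff_contDiffAt]
    have hsymm : ContMDiffAt 𝓘(ℝ, E) I (⊤ : ℕ∞) (extChartAt I p).symm (extChartAt I p p) :=
      (contMDiffOn_extChartAt_symm p).contMDiffAt (extChartAt_target_mem_nhds p)
    have h1 := ContMDiffAt.comp_of_eq h hsymm (extChartAt_to_inv p)
    refine h1.congr_of_eventuallyEq ?_
    filter_upwards [extChartAt_target_mem_nhds (I := I) p] with y hy
    have hy' := (extChartAt I p).map_target hy
    rw [extChartAt_source] at hy'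
    rw [Function.comp_apply, key _ hy', (extChartAt I p).right_inv hy]
  · intro h
    have h1 := (contMDiffAt_iff_contDiffAt.mpr h).comp p (contMDiffAt_extChartAt (n := (⊤ : ℕ∞)))
    refine h1.congr_of_eventuallyEq ?_
    filter_upwards [hs] with x hx
    exact key x hx

-- The inverse of a product chart is the product of the inverse charts.
omit [FiniteDimensional ℝ E] in
theorem coordFrame_prod (z : M × M) {y : E × E} (hy : y ∈ (extChartAt (I.prod I) z).target) :
    coordFrame (I.prod I) z y =
      ((coordFrame I z.1 y.1 : E →L[ℝ] E).prodMap (coordFrame I z.2 y.2 : E →L[ℝ] E)) := by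
  rw [extChartAt_prod] at hy
  have hd : ∀ {x : M} {t : E}, t ∈ (extChartAt I x).target →
      HasMFDerivAt 𝓘(ℝ, E) I (extChartAt I x).symm t (mfderiv 𝓘(ℝ, E) I (extChartAt I x).symm t) := by
    intro x t ht
    have h := mdifferentiableWithinAt_extChartAt_symm (I := I) ht
    rw [I.range_eq_univ, mdifferentiableWithinAt_univ] at h
    exact h.hasMFDerivAt
  have h₁ := (hd hy.1).comp (I := 𝓘(ℝ, E × E)) y
    (hasFDerivAt_fst (𝕜 := ℝ) (p := y)).hasMFDerivAt
  have h₂ := (hd hy.2).comp (I := 𝓘(ℝ, E × E)) y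
    (hasFDerivAt_snd (𝕜 := ℝ) (p := y)).hasMFDerivAt
  -- The map is a variable here so that the equality is also substituted in the type of the
  -- derivative, which depends on it.
  have key : ∀ f : E × E → M × M,
      f = (fun y => ((extChartAt I z.1).symm y.1, (extChartAt I z.2).symm y.2)) →
      (mfderiv 𝓘(ℝ, E × E) (I.prod I) f y : E × E →L[ℝ] E × E) =
        (coordFrame I z.1 y.1 : E →L[ℝ] E).prodMap (coordFrame I z.2 y.2 : E →L[ℝ] E) := by
    rintro _ rfl
    exact (h₁.prodMk h₂).mfderiv
  exact key _ (by rw [extChartAt_prod]; rfl)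

/-- The product metric `π₁^* g + π₂^* g`. -/
def prodMetric (g : BilinField I M) : BilinField (I.prod I) (M × M) := fun z =>
  (bilinProd (g z.1 : E →L[ℝ] E →L[ℝ] ℝ) (g z.2) : E × E →L[ℝ] E × E →L[ℝ] ℝ)

/-- The form `π₁^* ω + π₂^* ω + π₁^* α ∧ π₂^* α`. -/
def prodFormField (α : FormField I M 1) (ω : FormField I M 2) :
    FormField (I.prod I) (M × M) 2 := fun z =>
  (prodForm (α z.1 : E [⋀^Fin 1]→L[ℝ] ℝ) (α z.2) (ω z.1 : E [⋀^Fin 2]→L[ℝ] ℝ) (ω z.2) :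
    (E × E) [⋀^Fin 2]→L[ℝ] ℝ)

theorem inChart_prodMetric (g : BilinField I M) (z : M × M) {y : E × E}
    (hy : y ∈ (extChartAt (I.prod I) z).target) :
    (prodMetric g).inChart z y = bilinProd (g.inChart z.1 y.1) (g.inChart z.2 y.2) := by
  unfold BilinField.inChart
  rw [coordFrame_prod z hy]
  rfl

theorem inChart_prodFormField (α : FormField I M 1) (ω : FormField I M 2)
    (z : M × M) {y : E × E} (hy : y ∈ (extChartAt (I.prod I) z).target) :
    (prodFormField α ω).inChart z y =
      prodForm (α.inChart z.1 y.1) (α.inChart z.2 y.2) (ω.inChart z.1 y.1) (ω.inChart z.2 y.2) := by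
  unfold FormField.inChart
  rw [coordFrame_prod z hy]
  rfl

omit [FiniteDimensional ℝ E] [I.Boundaryless] [IsManifold I (⊤ : ℕ∞) M] in
theorem dfst_apply (z : M × M) (u : TangentSpace (I.prod I) z) : dfst I z u = u.1 := by
  rw [dfst, mfderiv_fst]
  rfl

omit [FiniteDimensional ℝ E] [I.Boundaryless] [IsManifold I (⊤ : ℕ∞) M] in
theorem dsnd_apply (z : M × M) (u : TangentSpace (I.prod I) z) : dsnd I z u = u.2 := by
  rw [dsnd, mfderiv_snd]
  rfl

omit [I.Boundaryless] [IsManifold I (⊤ : ℕ∞) M] in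
theorem isProductMetric_prodMetric (g : BilinField I M) : IsProductMetric g (prodMetric g) := by
  intro z u v
  rw [dfst_apply, dfst_apply, dsnd_apply, dsnd_apply]
  rfl

omit [I.Boundaryless] [IsManifold I (⊤ : ℕ∞) M] in
theorem isProductForm_prodFormField (α : FormField I M 1)
    (ω : FormField I M 2) : IsProductForm α ω (prodFormField α ω) := by
  intro z u v
  rw [dfst_apply, dfst_apply, dsnd_apply, dsnd_apply]
  exact prodForm_apply (E := E) _ _ _ _ u v

theorem isSmooth_prodFormField {α : FormField I M 1} {ω : FormField I M 2}
    (hα : α.IsSmooth) (hω : ω.IsSmooth) : (prodFormField α ω).IsSmooth := by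
  intro z
  refine ContDiffOn.congr ?_ fun y hy => inChart_prodFormField α ω z hy
  rw [extChartAt_prod]
  exact contDiffOn_prodForm (hα z.1) (hα z.2) (hω z.1) (hω z.2)

omit [FiniteDimensional ℝ E] [IsManifold I (⊤ : ℕ∞) M] in
theorem FormField.IsSmooth.differentiableAt {k : ℕ} {η : FormField I M k} (hη : η.IsSmooth)
    {p : M} {y : E} (hy : y ∈ (extChartAt I p).target) : DifferentiableAt ℝ (η.inChart p) y :=
  ((hη p).contDiffAt ((isOpen_extChartAt_target p).mem_nhds hy)).differentiableAt (by simp)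

theorem isClosed_prodFormField {α : FormField I M 1} {ω : FormField I M 2}
    (hα : α.IsSmooth) (hω : ω.IsSmooth) (dα : α.IsClosed) (dω : ω.IsClosed) :
    (prodFormField α ω).IsClosed := by
  intro z y hy
  have hev : (prodFormField α ω).inChart z =ᶠ[𝓝 y] fun y : E × E =>
      prodForm (α.inChart z.1 y.1) (α.inChart z.2 y.2) (ω.inChart z.1 y.1) (ω.inChart z.2 y.2) := by
    filter_upwards [(isOpen_extChartAt_target z).mem_nhds hy] with y' hy'
    exact inChart_prodFormField α ω z hy'
  rw [hev.extDeriv_eq]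
  rw [extChartAt_prod] at hy
  exact extDeriv_prodForm (hα.differentiableAt hy.1) (hα.differentiableAt hy.2)
    (hω.differentiableAt hy.1) (hω.differentiableAt hy.2) (dα _ _ hy.1) (dα _ _ hy.2)
    (dω _ _ hy.1) (dω _ _ hy.2)

theorem contDiffAt_inChart_prodMetric {g : BilinField I M} {z : M × M}
    (h₁ : ContDiffAt ℝ (⊤ : ℕ∞) (g.inChart z.1) (extChartAt I z.1 z.1))
    (h₂ : ContDiffAt ℝ (⊤ : ℕ∞) (g.inChart z.2) (extChartAt I z.2 z.2)) :
    ContDiffAt ℝ (⊤ : ℕ∞) ((prodMetric g).inChart z) (extChartAt (I.prod I) z z) := by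
  have hev : (prodMetric g).inChart z =ᶠ[𝓝 (extChartAt (I.prod I) z z)] fun y : E × E =>
      bilinProd (g.inChart z.1 y.1) (g.inChart z.2 y.2) := by
    filter_upwards [extChartAt_target_mem_nhds z] with y hy
    exact inChart_prodMetric g z hy
  refine ContDiffAt.congr_of_eventuallyEq ?_ hev
  have e : extChartAt (I.prod I) z z = (extChartAt I z.1 z.1, extChartAt I z.2 z.2) := by
    rw [extChartAt_prod]; rfl
  rw [e]
  exact contDiffAt_bilinProd h₁ h₂

-- `coordFrame` is injective on the whole chart target: the trivialization of the tangent bundle is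
-- a left inverse.
omit [FiniteDimensional ℝ E] [IsManifold I (⊤ : ℕ∞) M] in
theorem inChart_pos [IsManifold I 1 M] {g : BilinField I M}
    (pos : ∀ (p : M) (v : TangentSpace I p), v ≠ 0 → 0 < g p v v) (p : M) {y : E}
    (hy : y ∈ (extChartAt I p).target) (v : E) (hv : v ≠ 0) : 0 < g.inChart p y v v := by
  refine pos _ (coordFrame I p y v) fun h => hv ?_
  have hx := (extChartAt I p).map_target hy
  rw [extChartAt_source] at hx
  have h1 := (trivializationAt E (TangentSpace I) p).continuousLinearMapAt_symmL (R := ℝ)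
    (b := (extChartAt I p).symm y) (by simpa using hx) v
  rw [TangentBundle.symmL_trivializationAt hx, I.range_eq_univ, mfderivWithin_univ,
    (extChartAt I p).right_inv hy] at h1
  have h2 : mfderiv 𝓘(ℝ, E) I (extChartAt I p).symm y v = 0 := h
  rw [← h1]
  exact (congrArg _ h2).trans (map_zero _)

theorem curvature_prodMetric [IsManifold I 1 M] {g : BilinField I M}
    (pos : ∀ (p : M) (v : TangentSpace I p), v ≠ 0 → 0 < g p v v)
    (smooth : ∀ p, ContDiffAt ℝ (⊤ : ℕ∞) (g.inChart p) (extChartAt I p p)) (z : M × M)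
    (v w : E × E) :
    (curvature (prodMetric g) z v w : E × E →L[ℝ] E × E) =
      (curvature g z.1 v.1 w.1 : E →L[ℝ] E).prodMap (curvature g z.2 v.2 w.2 : E →L[ℝ] E) := by
  have hev : (prodMetric g).inChart z =ᶠ[𝓝 (extChartAt (I.prod I) z z)] fun y : E × E =>
      bilinProd (g.inChart z.1 y.1) (g.inChart z.2 y.2) := by
    filter_upwards [extChartAt_target_mem_nhds z] with y hy
    exact inChart_prodMetric g z hy
  have e : extChartAt (I.prod I) z z = (extChartAt I z.1 z.1, extChartAt I z.2 z.2) := by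
    rw [extChartAt_prod]; rfl
  have hle : (2 : WithTop ℕ∞) ≤ ((⊤ : ℕ∞) : WithTop ℕ∞) :=
    WithTop.coe_le_coe.mpr (le_top (a := (2 : ℕ∞)))
  have hpos : ∀ p : M, ∀ᶠ x in 𝓝 (extChartAt I p p), ∀ v, v ≠ 0 → 0 < g.inChart p x v v :=
    fun p => by
      filter_upwards [extChartAt_target_mem_nhds p] with y hy
      exact inChart_pos pos p hy
  unfold curvature
  rw [e] at hev ⊢
  exact curvatureMap_prod hev ((smooth z.1).of_le hle) ((smooth z.2).of_le hle) (hpos z.1)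
    (hpos z.2) v w

end ProductCharts

/-! ### Linear algebra of almost contact metric structures -/

section Pointwise

variable {E : Type*} [NormedAddCommGroup E] [NormedSpace ℝ E] [FiniteDimensional ℝ E]
  {ι κ : Type*} [Fintype ι] [DecidableEq ι] [Fintype κ] [DecidableEq κ]

/-- The basis `e` is orthonormal for the scalar product `g`. -/
def IsOrtho (g : E →L[ℝ] E →L[ℝ] ℝ) (e : Module.Basis ι ℝ E) : Prop :=
  ∀ i j, g (e i) (e j) = if i = j then 1 else 0

theorem formInner_eq_sum {g : E →L[ℝ] E →L[ℝ] ℝ} (β γ : E →ₗ[ℝ] E →ₗ[ℝ] ℝ)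
    {e : Module.Basis ι ℝ E} (he : IsOrtho g e) :
    formInner g (fun u v => β u v) (fun u v => γ u v) =
      (1 / 2) * ∑ i, ∑ j, β (e i) (e j) * γ (e i) (e j) := by
  have h1 : ∀ u u', metricTrace g (fun v v' => β u v * γ u' v') = ∑ j, β u (e j) * γ u' (e j) :=
    fun u u' => metricTrace_eq_sum g (LinearMap.mk₂ ℝ (fun v v' => β u v * γ u' v')
      (by intros; simp; ring) (by intros; simp; ring) (by intros; simp; ring)
      (by intros; simp; ring)) e he
  unfold formInner
  simp only [h1]
  refine congrArg ((1 / 2 : ℝ) * ·)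
    (metricTrace_eq_sum g (LinearMap.mk₂ ℝ (fun u u' => ∑ j, β u (e j) * γ u' (e j))
      (by intros; simp [add_mul, Finset.sum_add_distrib])
      (by intros; simp [Finset.mul_sum, mul_assoc])
      (by intros; simp [mul_add, Finset.sum_add_distrib])
      (by intros; simp [Finset.mul_sum, mul_left_comm])) e he)

theorem formInner_comm {g : E →L[ℝ] E →L[ℝ] ℝ} (β γ : E →ₗ[ℝ] E →ₗ[ℝ] ℝ)
    {e : Module.Basis ι ℝ E} (he : IsOrtho g e) :
    formInner g (fun u v => β u v) (fun u v => γ u v) =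
      formInner g (fun u v => γ u v) (fun u v => β u v) := by
  rw [formInner_eq_sum β γ he, formInner_eq_sum γ β he]
  simp only [mul_comm]

omit [Fintype ι] [Fintype κ] in
theorem IsOrtho.prod {g₁ g₂ : E →L[ℝ] E →L[ℝ] ℝ} {e : Module.Basis ι ℝ E}
    {f : Module.Basis κ ℝ E} (he : IsOrtho g₁ e) (hf : IsOrtho g₂ f) :
    IsOrtho (bilinProd g₁ g₂) (e.prod f) := by
  rintro (i | i) (j | j) <;> simp [he _ _, hf _ _]

/-- In the product basis, `β` vanishes on mixed pairs, so only the diagonal blocks of `γ` count.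
This is what removes $\alpha\wedge\alpha$ from $\langle\rho^*,\Omega\rangle$. -/
theorem formInner_prod {g₁ g₂ : E →L[ℝ] E →L[ℝ] ℝ} {e : Module.Basis ι ℝ E}
    {f : Module.Basis κ ℝ E} (he : IsOrtho g₁ e) (hf : IsOrtho g₂ f)
    {β γ : E × E →ₗ[ℝ] E × E →ₗ[ℝ] ℝ} {β₁ β₂ γ₁ γ₂ : E →ₗ[ℝ] E →ₗ[ℝ] ℝ}
    (hβ : ∀ u v, β u v = β₁ u.1 v.1 + β₂ u.2 v.2)
    (hγ₁ : ∀ u v, γ (u, 0) (v, 0) = γ₁ u v) (hγ₂ : ∀ u v, γ (0, u) (0, v) = γ₂ u v) :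
    formInner (bilinProd g₁ g₂) (fun u v => β u v) (fun u v => γ u v) =
      formInner g₁ (fun u v => β₁ u v) (fun u v => γ₁ u v) +
        formInner g₂ (fun u v => β₂ u v) (fun u v => γ₂ u v) := by
  rw [formInner_eq_sum β γ (he.prod hf), formInner_eq_sum β₁ γ₁ he, formInner_eq_sum β₂ γ₂ hf,
    ← mul_add]
  simp [Fintype.sum_sum_type, hβ, hγ₁, hγ₂]

omit [FiniteDimensional ℝ E] in
theorem IsOrtho.inner_basis {g : E →L[ℝ] E →L[ℝ] ℝ} {e : Module.Basis ι ℝ E} (he : IsOrtho g e)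
    (i : ι) (v : E) : g (e i) v = e.repr v i := by
  conv_lhs => rw [← e.sum_repr v]
  simp only [map_sum, map_smul, he i, smul_eq_mul, mul_ite, mul_one, mul_zero,
    Finset.sum_ite_eq, Finset.mem_univ, if_true]

omit [FiniteDimensional ℝ E] in
theorem sum_coord_mul {g : E →L[ℝ] E →L[ℝ] ℝ} {e : Module.Basis ι ℝ E} (he : IsOrtho g e)
    (u v : E) : g u v = ∑ i, g u (e i) * g (e i) v := by
  conv_lhs => rw [← e.sum_repr v]
  simp only [map_sum, map_smul, he.inner_basis, smul_eq_mul, mul_comm]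

theorem update_pair_zero {V : Type*} (u v x : V) : Function.update ![u, v] 0 x = ![x, v] := by
  ext i; fin_cases i <;> simp

theorem update_pair_one {V : Type*} (u v x : V) : Function.update ![u, v] 1 x = ![u, x] := by
  ext i; fin_cases i <;> simp

/-- A `2`-form as a bilinear map. -/
def formBilin (w : E [⋀^Fin 2]→L[ℝ] ℝ) : E →ₗ[ℝ] E →ₗ[ℝ] ℝ :=
  LinearMap.mk₂ ℝ (fun u v => w ![u, v])
    (fun u u' v => by
      have h := w.map_update_add ![u, v] 0 u u'
      rwa [update_pair_zero, update_pair_zero, update_pair_zero] at h)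
    (fun c u v => by
      have h := w.map_update_smul ![u, v] 0 c u
      rwa [update_pair_zero, update_pair_zero] at h)
    (fun u v v' => by
      have h := w.map_update_add ![u, v] 1 v v'
      rwa [update_pair_one, update_pair_one, update_pair_one] at h)
    (fun c u v => by
      have h := w.map_update_smul ![u, v] 1 c v
      rwa [update_pair_one, update_pair_one] at h)

omit [FiniteDimensional ℝ E] in
@[simp] theorem formBilin_apply (w : E [⋀^Fin 2]→L[ℝ] ℝ) (u v : E) :
    formBilin w u v = w ![u, v] := rfl

omit [FiniteDimensional ℝ E] in
theorem form_neg_swap (w : E [⋀^Fin 2]→L[ℝ] ℝ) (u v : E) : w ![u, v] = -w ![v, u] := by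
  have h : w (![v, u] ∘ Equiv.swap 0 1) = -w ![v, u] :=
    w.toAlternatingMap.map_swap ![v, u] (by simp)
  rw [← h]
  congr 1
  ext i
  fin_cases i <;> simp

theorem formBilin_prodForm_left (a₁ a₂ : E [⋀^Fin 1]→L[ℝ] ℝ) (w₁ w₂ : E [⋀^Fin 2]→L[ℝ] ℝ)
    (u v : E) : formBilin (prodForm a₁ a₂ w₁ w₂) (u, 0) (v, 0) = formBilin w₁ u v := by
  have ha : a₂ ![0] = 0 := a₂.map_coord_zero 0 rfl
  have hw : w₂ ![0, 0] = 0 := w₂.map_coord_zero 0 rfl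
  simp [prodForm_apply, ha, hw]

theorem formBilin_prodForm_right (a₁ a₂ : E [⋀^Fin 1]→L[ℝ] ℝ) (w₁ w₂ : E [⋀^Fin 2]→L[ℝ] ℝ)
    (u v : E) : formBilin (prodForm a₁ a₂ w₁ w₂) (0, u) (0, v) = formBilin w₂ u v := by
  have ha : a₁ ![0] = 0 := a₁.map_coord_zero 0 rfl
  have hw : w₁ ![0, 0] = 0 := w₁.map_coord_zero 0 rfl
  simp [prodForm_apply, ha, hw]

theorem fundEndo_eq_of_inner {g : E →L[ℝ] E →L[ℝ] ℝ} (pos : ∀ v, v ≠ 0 → 0 < g v v)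
    {w : E [⋀^Fin 2]→L[ℝ] ℝ} {u x : E} (h : ∀ v, g x v = w ![u, v]) : fundEndo g w u = x :=
  eq_of_pos pos fun v => by rw [inner_fundEndo g pos, h]

/-- `fundEndo` is a bare function; its linearity comes from its characterization by scalar products,
and is needed to evaluate traces in a basis. -/
theorem exists_linear_fundEndo {g : E →L[ℝ] E →L[ℝ] ℝ} (pos : ∀ v, v ≠ 0 → 0 < g v v)
    (w : E [⋀^Fin 2]→L[ℝ] ℝ) : ∃ J : E →ₗ[ℝ] E, ∀ u, fundEndo g w u = J u := by
  refine ⟨{ toFun := fundEndo g w, map_add' := fun u v => ?_, map_smul' := fun c u => ?_ },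
    fun u => rfl⟩
  · refine fundEndo_eq_of_inner pos fun x => ?_
    have h := (formBilin w).map_add₂ u v x
    simp only [formBilin_apply] at h
    simp [inner_fundEndo g pos, h]
  · refine fundEndo_eq_of_inner pos fun x => ?_
    have h := (formBilin w).map_smul₂ c u x
    simp only [formBilin_apply] at h
    simp [inner_fundEndo g pos, h]

/-- The scalar product, the `1`-form and the `2`-form of an almost contact metric structure: there
is an adapted orthonormal coframe. -/
def IsAdapted {n : ℕ} (g : E →L[ℝ] E →L[ℝ] ℝ) (a : E [⋀^Fin 1]→L[ℝ] ℝ) (w : E [⋀^Fin 2]→L[ℝ] ℝ)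
    (e : Module.Basis ((Fin n × Fin 2) ⊕ Unit) ℝ E) : Prop :=
  IsOrtho g e ∧ (∀ u, a ![u] = e.coord (.inr ()) u) ∧
    ∀ u v, w ![u, v] = ∑ k : Fin n,
      (e.coord (.inl (k, 0)) u * e.coord (.inl (k, 1)) v
        - e.coord (.inl (k, 1)) u * e.coord (.inl (k, 0)) v)

/-- In the adapted basis `J` sends $e_{2k-1}$ to $e_{2k}$ and $e_{2k}$ to $-e_{2k-1}$, and kills
$\xi=e_{2n+1}$. -/
theorem IsAdapted.exists_reeb {n : ℕ} {g : E →L[ℝ] E →L[ℝ] ℝ} (pos : ∀ v, v ≠ 0 → 0 < g v v)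
    (symm : ∀ u v, g u v = g v u) {a : E [⋀^Fin 1]→L[ℝ] ℝ} {w : E [⋀^Fin 2]→L[ℝ] ℝ}
    {e : Module.Basis ((Fin n × Fin 2) ⊕ Unit) ℝ E} (h : IsAdapted g a w e) :
    ∃ ξ : E, (∀ v, g ξ v = a ![v]) ∧ a ![ξ] = 1 ∧ fundEndo g w ξ = 0 ∧
      (∀ u, a ![fundEndo g w u] = 0) ∧
      ∀ u, fundEndo g w (fundEndo g w u) = -u + a ![u] • ξ := by
  obtain ⟨he, ha, hw⟩ := h
  have hc : ∀ i v, e.coord i v = g v (e i) := by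
    intro i v
    rw [symm, he.inner_basis]
    rfl
  have hJ : ∀ u i, e.coord i (fundEndo g w u) = w ![u, e i] := fun u i => by
    rw [hc, inner_fundEndo g pos]
  have h0 : ∀ u k, e.coord (.inl (k, 0)) (fundEndo g w u) = -e.coord (.inl (k, 1)) u := by
    intro u k
    rw [hJ, hw]
    simp [Finsupp.single_apply]
  have h1 : ∀ u k, e.coord (.inl (k, 1)) (fundEndo g w u) = e.coord (.inl (k, 0)) u := by
    intro u k
    rw [hJ, hw]
    simp [Finsupp.single_apply]
  have h2 : ∀ u, e.coord (.inr ()) (fundEndo g w u) = 0 := by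
    intro u
    rw [hJ, hw]
    simp
  refine ⟨e (.inr ()), fun v => ?_, ?_, ?_, fun u => ?_, fun u => ?_⟩
  · rw [ha, hc, symm]
  · simp [ha]
  · refine fundEndo_eq_of_inner pos fun v => ?_
    rw [hw]
    simp
  · rw [ha, h2]
  · refine e.ext_elem fun i => ?_
    change e.coord i _ = e.coord i _
    rcases i with ⟨k, j⟩ | _
    · fin_cases j
      · change e.coord (.inl (k, 0)) _ = e.coord (.inl (k, 0)) _
        rw [h0, h1]
        simp
      · change e.coord (.inl (k, 1)) _ = e.coord (.inl (k, 1)) _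
        rw [h1, h0]
        simp
    · rw [h2, ha]
      simp

/-! ### The almost complex structure of the product. -/

section Product

variable {g₁ g₂ : E →L[ℝ] E →L[ℝ] ℝ} {a₁ a₂ : E [⋀^Fin 1]→L[ℝ] ℝ} {w₁ w₂ : E [⋀^Fin 2]→L[ℝ] ℝ}

/-- The mixed terms are $\alpha_1(u_1)\alpha_2(v_2)=g_2(\alpha_1(u_1)\xi_2,v_2)$ and its counterpart
with the factors exchanged. -/
theorem fundEndo_prod (pos₁ : ∀ v, v ≠ 0 → 0 < g₁ v v) (pos₂ : ∀ v, v ≠ 0 → 0 < g₂ v v) {ξ₁ ξ₂ : E}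
    (h₁ : ∀ v, g₁ ξ₁ v = a₁ ![v]) (h₂ : ∀ v, g₂ ξ₂ v = a₂ ![v]) (u : E × E) :
    fundEndo (bilinProd g₁ g₂) (prodForm a₁ a₂ w₁ w₂) u =
      (fundEndo g₁ w₁ u.1 - a₂ ![u.2] • ξ₁, fundEndo g₂ w₂ u.2 + a₁ ![u.1] • ξ₂) := by
  refine fundEndo_eq_of_inner (bilinProd_pos pos₁ pos₂) fun v => ?_
  rw [prodForm_apply]
  simp [inner_fundEndo _ pos₁, inner_fundEndo _ pos₂, h₁, h₂]
  ring

omit [FiniteDimensional ℝ E] in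
theorem oneForm_map_add_smul (a : E [⋀^Fin 1]→L[ℝ] ℝ) (u v : E) (c : ℝ) :
    a ![u + c • v] = a ![u] + c * a ![v] := by
  have e : ∀ x : E, Function.update ![u] 0 x = ![x] := fun x => by
    ext i; fin_cases i; simp
  have h1 := a.map_update_add ![u] 0 u (c • v)
  have h2 := a.map_update_smul ![u] 0 c v
  rw [e, e, e] at h1
  rw [e, e] at h2
  rw [h1, h2, smul_eq_mul]

/-- As $J\xi_1=\xi_2$ and $J\xi_2=-\xi_1$, the Reeb terms contribute $-\alpha_i\otimes\xi_i$,
cancelling the defect in $J_i^2=-1+\alpha_i\otimes\xi_i$. -/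
theorem fundEndo_prod_fundEndo_prod {n : ℕ} (pos₁ : ∀ v, v ≠ 0 → 0 < g₁ v v)
    (pos₂ : ∀ v, v ≠ 0 → 0 < g₂ v v) (symm₁ : ∀ u v, g₁ u v = g₁ v u)
    (symm₂ : ∀ u v, g₂ u v = g₂ v u) {e f : Module.Basis ((Fin n × Fin 2) ⊕ Unit) ℝ E}
    (h₁ : IsAdapted g₁ a₁ w₁ e) (h₂ : IsAdapted g₂ a₂ w₂ f) (u : E × E) :
    fundEndo (bilinProd g₁ g₂) (prodForm a₁ a₂ w₁ w₂)
      (fundEndo (bilinProd g₁ g₂) (prodForm a₁ a₂ w₁ w₂) u) = -u := by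
  obtain ⟨ξ₁, r₁, n₁, k₁, t₁, s₁⟩ := h₁.exists_reeb pos₁ symm₁
  obtain ⟨ξ₂, r₂, n₂, k₂, t₂, s₂⟩ := h₂.exists_reeb pos₂ symm₂
  obtain ⟨J₁, hJ₁⟩ := exists_linear_fundEndo pos₁ w₁
  obtain ⟨J₂, hJ₂⟩ := exists_linear_fundEndo pos₂ w₂
  rw [fundEndo_prod pos₁ pos₂ r₁ r₂, fundEndo_prod pos₁ pos₂ r₁ r₂]
  simp only [sub_eq_add_neg, ← neg_smul, oneForm_map_add_smul, t₁, t₂, n₁, n₂]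
  simp only [hJ₁, hJ₂] at s₁ s₂ k₁ k₂ ⊢
  refine Prod.ext ?_ ?_ <;> simp [s₁, s₂, k₁, k₂]

end Product

/-- $g(Ju,Jv)=\omega(u,Jv)=-\omega(Jv,u)=-g(J^2v,u)=g(v,u)$. -/
theorem fundEndo_hermitian {g : E →L[ℝ] E →L[ℝ] ℝ} (pos : ∀ v, v ≠ 0 → 0 < g v v)
    (symm : ∀ u v, g u v = g v u) {w : E [⋀^Fin 2]→L[ℝ] ℝ}
    (sq : ∀ u, fundEndo g w (fundEndo g w u) = -u) (u v : E) :
    g (fundEndo g w u) (fundEndo g w v) = g u v := by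
  rw [inner_fundEndo g pos, form_neg_swap, ← inner_fundEndo g pos, sq, symm u v]
  simp

/-- For each `i`, $\sum_j\omega(e_i,e_j)^2=|Je_i|^2=|e_i|^2=1$. -/
theorem formInner_self_of_hermitian {g : E →L[ℝ] E →L[ℝ] ℝ} (pos : ∀ v, v ≠ 0 → 0 < g v v)
    (symm : ∀ u v, g u v = g v u) {w : E [⋀^Fin 2]→L[ℝ] ℝ}
    (sq : ∀ u, fundEndo g w (fundEndo g w u) = -u) {e : Module.Basis ι ℝ E} (he : IsOrtho g e)
    (c : ℝ) : formInner g (fun u v => c * w ![u, v]) (fun u v => w ![u, v]) =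
      (1 / 2) * (c * Fintype.card ι) := by
  have h := formInner_eq_sum (c • formBilin w) (formBilin w) he
  have h1 : ∀ i, ∑ j, w ![e i, e j] * w ![e i, e j] = 1 := by
    intro i
    have h2 := sum_coord_mul he (fundEndo g w (e i)) (fundEndo g w (e i))
    rw [fundEndo_hermitian pos symm sq, he, if_pos rfl] at h2
    rw [h2]
    refine Finset.sum_congr rfl fun j _ => ?_
    rw [symm (e j), inner_fundEndo g pos]
  refine h.trans ?_
  simp [mul_assoc, ← Finset.mul_sum, h1]
  ring

theorem metricTrace_mul_self {g : E →L[ℝ] E →L[ℝ] ℝ} {e : Module.Basis ι ℝ E} (he : IsOrtho g e)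
    (c : ℝ) : metricTrace g (fun u v => c * g u v) = c * Fintype.card ι := by
  refine (metricTrace_eq_sum g (LinearMap.mk₂ ℝ (fun u v => c * g u v)
      (by intros; simp; ring) (by intros; simp; ring) (by intros; simp; ring)
      (by intros; simp; ring)) e he).trans ?_
  simp [he _ _, mul_comm]

theorem IsAdapted.mul_formInner {n : ℕ} {g : E →L[ℝ] E →L[ℝ] ℝ} {a : E [⋀^Fin 1]→L[ℝ] ℝ}
    {w : E [⋀^Fin 2]→L[ℝ] ℝ} {e : Module.Basis ((Fin n × Fin 2) ⊕ Unit) ℝ E}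
    (h : IsAdapted g a w e) (S : E →ₗ[ℝ] E →ₗ[ℝ] ℝ) :
    n * (1 / (n : ℝ) * formInner g (fun u v => w ![u, v]) (fun u v => S u v)) =
      formInner g (fun u v => S u v) (fun u v => w ![u, v]) := by
  have hc : formInner g (fun u v => w ![u, v]) (fun u v => S u v) =
      formInner g (fun u v => S u v) (fun u v => w ![u, v]) := formInner_comm (formBilin w) S h.1
  rw [hc]
  rcases Nat.eq_zero_or_pos n with rfl | hn
  -- For `n = 0` the form `w` is an empty sum, so both sides vanish.
  · have h0 := formInner_eq_sum S (formBilin w) h.1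
    simp only [formBilin_apply, h.2.2, Finset.univ_eq_empty, Finset.sum_empty, mul_zero,
      Finset.sum_const_zero] at h0
    simp only [h.2.2, Finset.univ_eq_empty, Finset.sum_empty, Nat.cast_zero, zero_mul]
    exact h0.symm
  · have : (n : ℝ) ≠ 0 := by positivity
    field_simp

/-- The `*`-Ricci form of a curvature-like tensor. -/
def starForm (g : E →L[ℝ] E →L[ℝ] ℝ) (w : E [⋀^Fin 2]→L[ℝ] ℝ) (T : E → E → E →L[ℝ] E)
    (X Y : E) : ℝ :=
  metricTrace g fun u v => g (T u (fundEndo g w v) X) Y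

theorem starForm_eq_sum {g : E →L[ℝ] E →L[ℝ] ℝ} (pos : ∀ v, v ≠ 0 → 0 < g v v)
    (w : E [⋀^Fin 2]→L[ℝ] ℝ) (T : E →ₗ[ℝ] E →ₗ[ℝ] (E →L[ℝ] E)) {e : Module.Basis ι ℝ E}
    (he : IsOrtho g e) (X Y : E) :
    starForm g w (fun u v => T u v) X Y = ∑ i, g (T (e i) (fundEndo g w (e i)) X) Y := by
  obtain ⟨J, hJ⟩ := exists_linear_fundEndo pos w
  unfold starForm
  simp only [hJ]
  exact metricTrace_eq_sum g (LinearMap.mk₂ ℝ (fun u v => g (T u (J v) X) Y)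
    (by intros; simp) (by intros; simp) (by intros; simp) (by intros; simp)) e he

/-- `formInner_eq_sum` applies to bilinear maps only; this makes $\rho^*$ one. -/
theorem exists_bilin_starForm {g : E →L[ℝ] E →L[ℝ] ℝ} (pos : ∀ v, v ≠ 0 → 0 < g v v)
    (w : E [⋀^Fin 2]→L[ℝ] ℝ) (T : E →ₗ[ℝ] E →ₗ[ℝ] (E →L[ℝ] E)) {e : Module.Basis ι ℝ E}
    (he : IsOrtho g e) :
    ∃ S : E →ₗ[ℝ] E →ₗ[ℝ] ℝ, starForm g w (fun u v => T u v) = fun X Y => S X Y := by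
  refine ⟨LinearMap.mk₂ ℝ (fun X Y => ∑ i, g (T (e i) (fundEndo g w (e i)) X) Y)
    (by intros; simp [Finset.sum_add_distrib]) (by intros; simp [Finset.mul_sum])
    (by intros; simp [Finset.sum_add_distrib]) (by intros; simp [Finset.mul_sum]), ?_⟩
  ext X Y
  exact starForm_eq_sum pos w T he X Y

/-! ### The `*`-Ricci form of a product. -/

section StarProduct

variable {g₁ g₂ : E →L[ℝ] E →L[ℝ] ℝ} {a₁ a₂ : E [⋀^Fin 1]→L[ℝ] ℝ} {w₁ w₂ : E [⋀^Fin 2]→L[ℝ] ℝ}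

/-- For a basis vector $(e_i,0)$, $J(e_i,0)=(J_1e_i,\alpha_1(e_i)\xi_2)$. The second component of
$J(e_i,0)$ enters only through `T₂ 0 _`, which is zero; likewise for $(0,f_j)$. -/
theorem starForm_prod (pos₁ : ∀ v, v ≠ 0 → 0 < g₁ v v) (pos₂ : ∀ v, v ≠ 0 → 0 < g₂ v v) {ξ₁ ξ₂ : E}
    (h₁ : ∀ v, g₁ ξ₁ v = a₁ ![v]) (h₂ : ∀ v, g₂ ξ₂ v = a₂ ![v])
    {e : Module.Basis ι ℝ E} {f : Module.Basis κ ℝ E} (he : IsOrtho g₁ e) (hf : IsOrtho g₂ f)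
    (T : E × E →ₗ[ℝ] E × E →ₗ[ℝ] (E × E →L[ℝ] E × E)) (T₁ T₂ : E →ₗ[ℝ] E →ₗ[ℝ] (E →L[ℝ] E))
    (hT : ∀ u v, T u v = (T₁ u.1 v.1).prodMap (T₂ u.2 v.2)) (X Y : E × E) :
    starForm (bilinProd g₁ g₂) (prodForm a₁ a₂ w₁ w₂) (fun u v => T u v) X Y =
      starForm g₁ w₁ (fun u v => T₁ u v) X.1 Y.1 + starForm g₂ w₂ (fun u v => T₂ u v) X.2 Y.2 := by
  have ha : ∀ a : E [⋀^Fin 1]→L[ℝ] ℝ, a ![0] = 0 := fun a => a.map_coord_zero 0 rfl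
  rw [starForm_eq_sum (bilinProd_pos pos₁ pos₂) _ T (he.prod hf), starForm_eq_sum pos₁ w₁ T₁ he,
    starForm_eq_sum pos₂ w₂ T₂ hf]
  simp [Fintype.sum_sum_type, hT, fundEndo_prod pos₁ pos₂ h₁ h₂, ha]

end StarProduct

end Pointwise

/-- The curvature, as a bilinear function of its second and third arguments. -/
def curvatureBilin {E : Type*} [NormedAddCommGroup E] [NormedSpace ℝ E]
    (G : E → E →L[ℝ] E →L[ℝ] ℝ) (y : E) : E →ₗ[ℝ] E →ₗ[ℝ] (E →L[ℝ] E) :=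
  LinearMap.mk₂ ℝ (curvatureMap G y)
    (by intros; ext; simp [curvatureMap_apply]; abel)
    (by intros; ext; simp [curvatureMap_apply, smul_sub])
    (by intros; ext; simp [curvatureMap_apply]; abel)
    (by intros; ext; simp [curvatureMap_apply, smul_sub])

/-! ### The product of an almost cokähler manifold with itself -/

section Assembly

variable {E : Type*} [NormedAddCommGroup E] [NormedSpace ℝ E] [FiniteDimensional ℝ E]
  {H : Type*} [TopologicalSpace H] {I : ModelWithCorners ℝ E H} [I.Boundaryless]
  {M : Type*} [TopologicalSpace M] [ChartedSpace H M] [IsManifold I (⊤ : ℕ∞) M]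
  [IsManifold I 1 M]

/-- The unit ball of the sum lies in the product of the unit balls. -/
theorem isVonNBounded_bilinProd {B C : E →L[ℝ] E →L[ℝ] ℝ} (hB : ∀ v, v ≠ 0 → 0 < B v v)
    (hC : ∀ v, v ≠ 0 → 0 < C v v) (bB : Bornology.IsVonNBounded ℝ {v | B v v < 1})
    (bC : Bornology.IsVonNBounded ℝ {v | C v v < 1}) :
    Bornology.IsVonNBounded ℝ {v | bilinProd B C v v < 1} := by
  have nn : ∀ {D : E →L[ℝ] E →L[ℝ] ℝ}, (∀ v, v ≠ 0 → 0 < D v v) → ∀ v, 0 ≤ D v v := by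
    intro D hD v
    rcases eq_or_ne v 0 with rfl | h
    · simp
    · exact (hD v h).le
  rw [NormedSpace.isVonNBounded_iff] at *
  refine (bB.prod bC).subset fun v hv => ?_
  rw [mem_ofPred_eq, bilinProd_apply] at hv
  exact ⟨lt_of_le_of_lt (le_add_of_nonneg_right (nn hC _)) hv,
    lt_of_le_of_lt (le_add_of_nonneg_left (nn hB _)) hv⟩

/-- The product metric on `M × M` as a smooth Riemannian metric. -/
def prodRiemannianMetric [IsManifold (I.prod I) 1 (M × M)]
    (g : ContMDiffRiemannianMetric I (⊤ : ℕ∞) E (fun p : M => TangentSpace I p)) :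
    ContMDiffRiemannianMetric (I.prod I) (⊤ : ℕ∞) (E × E)
      (fun z : M × M => TangentSpace (I.prod I) z) where
  inner := prodMetric g.inner
  symm z u v := congrArg₂ (· + ·) (g.symm z.1 u.1 v.1) (g.symm z.2 u.2 v.2)
  pos z := bilinProd_pos (E := E) (g.pos z.1) (g.pos z.2)
  isVonNBounded z := isVonNBounded_bilinProd (E := E) (g.pos z.1) (g.pos z.2)
    (g.isVonNBounded z.1) (g.isVonNBounded z.2)
  contMDiff z := (contMDiffAt_iff_contDiffAt_inChart (prodMetric g.inner) z).mpr
    (contDiffAt_inChart_prodMetric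
      ((contMDiffAt_iff_contDiffAt_inChart g.inner z.1).mp (g.contMDiff z.1))
      ((contMDiffAt_iff_contDiffAt_inChart g.inner z.2).mp (g.contMDiff z.2)))

variable (g : ContMDiffRiemannianMetric I (⊤ : ℕ∞) E (fun p : M => TangentSpace I p))

theorem curvature_prod (z : M × M) (v w : E × E) :
    (curvature (prodMetric g.inner) z v w : E × E →L[ℝ] E × E) =
      (curvature g.inner z.1 v.1 w.1 : E →L[ℝ] E).prodMap
        (curvature g.inner z.2 v.2 w.2 : E →L[ℝ] E) :=
  curvature_prodMetric g.pos
    (fun p => (contMDiffAt_iff_contDiffAt_inChart g.inner p).mp (g.contMDiff p)) z v w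

theorem ricci_prod (z : M × M) (v w : E × E) :
    ricci (prodMetric g.inner) z v w =
      ricci g.inner z.1 v.1 w.1 + ricci g.inner z.2 v.2 w.2 := by
  have h := congrArg (fun A : E × E →L[ℝ] E × E => LinearMap.trace ℝ (E × E) A)
    (curvature_prod g z v w)
  exact h.trans (LinearMap.trace_prodMap' (R := ℝ) (M := E) (N := E) _ _)

theorem isEinstein_prod {τ : ℝ} (h : IsEinstein g.inner τ) :
    IsEinstein (prodMetric g.inner) τ := by
  intro z u v
  exact (ricci_prod g z u v).trans
    ((congrArg₂ (· + ·) (h _ _ _) (h _ _ _)).trans (mul_add _ _ _).symm)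

variable {g} {n : ℕ} {α : FormField I M 1} {ω : FormField I M 2}

omit [FiniteDimensional ℝ E] [I.Boundaryless] [IsManifold I (⊤ : ℕ∞) M] in
theorem IsAlmostCokahler.exists_isAdapted (hM : IsAlmostCokahler n g.inner α ω) (p : M) :
    ∃ e : Module.Basis ((Fin n × Fin 2) ⊕ Unit) ℝ E,
      IsAdapted (E := E) (g.inner p) (α p) (ω p) e :=
  hM.coframe p

omit [I.Boundaryless] [IsManifold I (⊤ : ℕ∞) M] in
theorem fundEndo_prodFormField_sq (hM : IsAlmostCokahler n g.inner α ω) (z : M × M) (u : E × E) :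
    fundEndo (V := E × E) (bilinProd (E := E) (g.inner z.1) (g.inner z.2))
      (prodFormField α ω z)
      (fundEndo (V := E × E) (bilinProd (E := E) (g.inner z.1) (g.inner z.2))
        (prodFormField α ω z) u) = -u := by
  obtain ⟨e, he⟩ := hM.exists_isAdapted z.1
  obtain ⟨f, hf⟩ := hM.exists_isAdapted z.2
  exact fundEndo_prod_fundEndo_prod (E := E) (g.pos z.1) (g.pos z.2) (g.symm z.1) (g.symm z.2)
    he hf u

theorem isAlmostKahler_prod (hM : IsAlmostCokahler n g.inner α ω) :
    IsAlmostKahler (prodMetric g.inner) (prodFormField α ω) where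
  smooth := isSmooth_prodFormField hM.smooth_one hM.smooth_two
  closed := isClosed_prodFormField hM.smooth_one hM.smooth_two hM.closed_one hM.closed_two
  complex z u := fundEndo_prodFormField_sq hM z u
  hermitian z u v := fundEndo_hermitian (E := E × E)
    (bilinProd_pos (E := E) (g.pos z.1) (g.pos z.2))
    (fun u v => congrArg₂ (· + ·) (g.symm z.1 u.1 v.1) (g.symm z.2 u.2 v.2))
    (fundEndo_prodFormField_sq hM z) u v

theorem scalarCurvature_prod (hM : IsAlmostCokahler n g.inner α ω) {τ : ℝ}
    (hτ : IsEinstein g.inner τ) (z : M × M) :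
    scalarCurvature (prodMetric g.inner) z = (4 * n + 2) * τ := by
  obtain ⟨e, he⟩ := hM.exists_isAdapted z.1
  obtain ⟨f, hf⟩ := hM.exists_isAdapted z.2
  have h1 : ricci (prodMetric g.inner) z = fun u v => τ * prodMetric g.inner z u v := by
    ext u v
    exact isEinstein_prod g hτ z u v
  unfold scalarCurvature
  rw [h1]
  refine (metricTrace_mul_self (E := E × E) (IsOrtho.prod (E := E) he.1 hf.1) τ).trans ?_
  simp only [Fintype.card_sum, Fintype.card_prod, Fintype.card_fin, Fintype.card_unit]
  push_cast
  ring

theorem hermitianScalar_prod (hM : IsAlmostCokahler n g.inner α ω) {τ : ℝ}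
    (hτ : IsEinstein g.inner τ) (z : M × M) :
    hermitianScalar (prodMetric g.inner) (prodFormField α ω) z = (4 * n + 2) * τ := by
  obtain ⟨e, he⟩ := hM.exists_isAdapted z.1
  obtain ⟨f, hf⟩ := hM.exists_isAdapted z.2
  have hK := isAlmostKahler_prod hM
  have hpos : ∀ u : E × E, u ≠ 0 →
      0 < bilinProd (E := E) (g.inner z.1) (g.inner z.2) u u :=
    bilinProd_pos (E := E) (g.pos z.1) (g.pos z.2)
  have hsymm : ∀ u v : E × E, bilinProd (E := E) (g.inner z.1) (g.inner z.2) u v =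
      bilinProd (E := E) (g.inner z.1) (g.inner z.2) v u :=
    fun u v => congrArg₂ (· + ·) (g.symm z.1 u.1 v.1) (g.symm z.2 u.2 v.2)
  -- As $J$ is orthogonal, the $J$-invariant part of $\tau h$ is $\tau h$ itself, so
  -- $\rho=\tau\Omega$.
  have h1 : ricciForm (prodMetric g.inner) (prodFormField α ω) z =
      fun u v => τ * prodFormField α ω z ![u, v] := by
    ext u v
    have h2 : prodMetric g.inner z
        (fundEndo (prodMetric g.inner z) (prodFormField α ω z) u) v =
        prodFormField α ω z ![u, v] :=
      inner_fundEndo (E := E × E) _ hpos (prodFormField α ω z) u v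
    simp only [ricciForm]
    rw [isEinstein_prod g hτ, isEinstein_prod g hτ, hK.hermitian, h2]
    ring
  unfold hermitianScalar
  rw [h1]
  have h3 := formInner_self_of_hermitian (E := E × E) hpos hsymm
    (w := prodFormField α ω z)
    (fundEndo_prodFormField_sq hM z) (IsOrtho.prod (E := E) he.1 hf.1) τ
  refine (congrArg (2 * ·) h3).trans ?_
  simp only [Fintype.card_sum, Fintype.card_prod, Fintype.card_fin, Fintype.card_unit]
  push_cast
  ring

/-- The curvature of `g` at `p`, as a bilinear function of its second and third arguments. -/
def curvatureTensor (g : BilinField I M) (p : M) : E →ₗ[ℝ] E →ₗ[ℝ] (E →L[ℝ] E) :=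
  curvatureBilin (g.inChart p) (extChartAt I p p)

-- The product $n\tau^*$ is all that enters $s^*$, and in this form no separate treatment of `n = 0`
-- is needed later.
omit [I.Boundaryless] [IsManifold I (⊤ : ℕ∞) M] in
theorem mul_tauStar (hM : IsAlmostCokahler n g.inner α ω) (p : M) :
    n * tauStar n g.inner ω p =
      formInner (g.inner p) (starRicciForm g.inner ω p) (fun u v => ω p ![u, v]) := by
  obtain ⟨e, he⟩ := hM.exists_isAdapted p
  obtain ⟨S, hS⟩ := exists_bilin_starForm (E := E) (g.pos p) (ω p) (curvatureTensor g.inner p) he.1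
  have h1 : starRicciForm g.inner ω p = fun X Y : E => S X Y := hS
  rw [tauStar, h1]
  exact IsAdapted.mul_formInner (E := E) he S

theorem starScalar_prod (hM : IsAlmostCokahler n g.inner α ω) (z : M × M) :
    starScalar (prodMetric g.inner) (prodFormField α ω) z =
      2 * n * (tauStar n g.inner ω z.1 + tauStar n g.inner ω z.2) := by
  obtain ⟨e, he⟩ := hM.exists_isAdapted z.1
  obtain ⟨f, hf⟩ := hM.exists_isAdapted z.2
  obtain ⟨ξ₁, r₁, -⟩ := IsAdapted.exists_reeb (E := E) (g.pos z.1) (g.symm z.1) he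
  obtain ⟨ξ₂, r₂, -⟩ := IsAdapted.exists_reeb (E := E) (g.pos z.2) (g.symm z.2) hf
  obtain ⟨S₁, hS₁⟩ := exists_bilin_starForm (E := E) (g.pos z.1) (ω z.1)
    (curvatureTensor g.inner z.1) he.1
  obtain ⟨S₂, hS₂⟩ := exists_bilin_starForm (E := E) (g.pos z.2) (ω z.2)
    (curvatureTensor g.inner z.2) hf.1
  obtain ⟨S, hS⟩ := exists_bilin_starForm (E := E × E)
    (bilinProd_pos (E := E) (g.pos z.1) (g.pos z.2)) (prodFormField α ω z)
    (curvatureTensor (prodMetric g.inner) z) (IsOrtho.prod (E := E) he.1 hf.1)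
  have hsum : ∀ X Y : E × E, S X Y = S₁ X.1 Y.1 + S₂ X.2 Y.2 := by
    intro X Y
    have h := starForm_prod (E := E) (w₁ := ω z.1) (w₂ := ω z.2) (g.pos z.1) (g.pos z.2) r₁ r₂
      he.1 hf.1 (curvatureTensor (prodMetric g.inner) z) (curvatureTensor g.inner z.1)
      (curvatureTensor g.inner z.2) (fun u v => curvature_prod g z u v) X Y
    rw [hS₁, hS₂] at h
    rw [← h]
    exact (congrFun (congrFun hS X) Y).symm
  -- The diagonal blocks of $\Omega$ are the two copies of $\omega$, since $\alpha\wedge\alpha$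
  -- vanishes on pairs tangent to the same factor.
  have h := formInner_prod (E := E) he.1 hf.1 (β := S)
    (γ := formBilin (E := E × E) (prodFormField α ω z)) (γ₁ := formBilin (E := E) (ω z.1))
    (γ₂ := formBilin (E := E) (ω z.2)) hsum
    (formBilin_prodForm_left (E := E) (α z.1) (α z.2) (ω z.1) (ω z.2))
    (formBilin_prodForm_right (E := E) (α z.1) (α z.2) (ω z.1) (ω z.2))
  rw [← hS, ← hS₁, ← hS₂] at h
  have e₁ := mul_tauStar hM z.1
  have e₂ := mul_tauStar hM z.2
  have h' : formInner (prodMetric g.inner z)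
      (starRicciForm (prodMetric g.inner) (prodFormField α ω) z)
      (fun u v => prodFormField α ω z ![u, v]) =
      n * tauStar n g.inner ω z.1 + n * tauStar n g.inner ω z.2 := by
    rw [e₁, e₂]
    exact h
  rw [starScalar, h']
  ring

end Assembly

end

end AlmostCokahler

theorem proposition4p4 (n : ℕ) {M : Type*} [TopologicalSpace M]
    [ChartedSpace (EuclideanSpace ℝ (Fin (2 * n + 1))) M] [IsManifold (𝓡 (2 * n + 1)) (⊤ : ℕ∞) M]
    (g : ContMDiffRiemannianMetric (𝓡 (2 * n + 1)) (⊤ : ℕ∞) (EuclideanSpace ℝ (Fin (2 * n + 1)))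
      (fun p : M => TangentSpace (𝓡 (2 * n + 1)) p))
    (α : AlmostCokahler.FormField (𝓡 (2 * n + 1)) M 1)
    (ω : AlmostCokahler.FormField (𝓡 (2 * n + 1)) M 2)
    (hM : AlmostCokahler.IsAlmostCokahler n g.inner α ω)
    (τ : ℝ) (hτ : AlmostCokahler.IsEinstein g.inner τ) :
    ∃ (h : ContMDiffRiemannianMetric ((𝓡 (2 * n + 1)).prod (𝓡 (2 * n + 1))) (⊤ : ℕ∞)
        (EuclideanSpace ℝ (Fin (2 * n + 1)) × EuclideanSpace ℝ (Fin (2 * n + 1)))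
        (fun z : M × M => TangentSpace ((𝓡 (2 * n + 1)).prod (𝓡 (2 * n + 1))) z))
      (Ω : AlmostCokahler.FormField ((𝓡 (2 * n + 1)).prod (𝓡 (2 * n + 1))) (M × M) 2),
      AlmostCokahler.IsProductMetric g.inner h.inner ∧
      AlmostCokahler.IsProductForm α ω Ω ∧
      AlmostCokahler.IsAlmostKahler h.inner Ω ∧
      AlmostCokahler.IsEinstein h.inner τ ∧
      (∀ z, AlmostCokahler.scalarCurvature h.inner z = (4 * n + 2) * τ) ∧
      (∀ z, AlmostCokahler.hermitianScalar h.inner Ω z = (4 * n + 2) * τ) ∧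
      (∀ z : M × M, AlmostCokahler.starScalar h.inner Ω z =
        2 * n * (AlmostCokahler.tauStar n g.inner ω z.1
          + AlmostCokahler.tauStar n g.inner ω z.2)) ∧
      (∀ c : ℝ, (∀ p, AlmostCokahler.tauStar n g.inner ω p = c) →
        ∀ z, AlmostCokahler.starScalar h.inner Ω z = 4 * n * c) := by
  have hstar := AlmostCokahler.starScalar_prod hM
  refine ⟨AlmostCokahler.prodRiemannianMetric g, AlmostCokahler.prodFormField α ω,
    AlmostCokahler.isProductMetric_prodMetric g.inner,
    AlmostCokahler.isProductForm_prodFormField α ω, AlmostCokahler.isAlmostKahler_prod hM,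
    AlmostCokahler.isEinstein_prod g hτ, AlmostCokahler.scalarCurvature_prod hM hτ,
    AlmostCokahler.hermitianScalar_prod hM hτ, hstar, fun c hc z => (hstar z).trans ?_⟩
  rw [hc, hc]
  ring
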